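/- Write a permutation $\sigma$ of $[n]=\{1,\dots,n\}$ as the word $\sigma(1)\sigma(2)\cdots\sigma(n)$, with $|\sigma|=n$; let $S_n$ be the set of all of them and $S_n(\tau)$ the set of those avoiding the pattern $\tau$. For a word $w$ of distinct integers let $\mathrm{red}(w)$ be the permutation obtained by replacing each letter by its rank among the letters of $w$. For $1\le a,b\le |\sigma|+1$ let $\sigma^{(a,b)}$ be the permutation obtained from $\sigma$ by adding $1$ to every letter $\ge b$ and then inserting $b$ at the $a$-th position. An index $i$ is an excedance of $\sigma$ if $\sigma(i)>i$ and a non-excedance if $\sigma(i)\le i$; if $i$ is an excedance, $\sigma(i)$ is called an excedance value. Matching algorithm. Let $e_1<\dots<e_r$ be the excedances and $a_1<\dots<a_{n-r}$ the non-excedances of $\sigma$. Start with $p=q=1$ and repeat until $p>r$ or $q>n-r$: if $e_p>a_q$, increase $q$ by $1$; otherwise, if $\sigma(e_p)<\sigma(a_q)$, increase $p$ by $1$; otherwise call $\sigma(e_p)$ a matched excedance value (matched with $a_q$) and increase both $p$ and $q$ by $1$. The map $\Theta$. For $\sigma\in S_n(321)$ let $(P,Q)$ be the pair of insertion and recording tableaux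 of $\sigma$ under the Robinson–Schensted correspondence (they have at most two rows). Let $\Psi(\sigma)$ be the path with $2n$ steps whose first half has, for $i=1,\dots,n$, an up-step if $i$ is in the first row of $P$ and a down-step if it is in the second row, and whose second half has, for $i=n,n-1,\dots,1$, a down-step if $i$ is in the first row of $Q$ and an up-step if it is in the second row. For a Dyck path $D$ of semi-length $n$, number its up-steps from left to right by $n,n-1,\dots,1$ and its down-steps from left to right by $1,2,\dots,n$; a tunnel of $D$ joins an up-step $u$ and a down-step $d$ such that $D=A\,u\,B\,d\,C$ with $B$ and $AC$ Dyck paths. Let $\Phi^{-1}(D)$ be the permutation that sends $a$ to $b$ when the up-step numbered $a$ and the down-step numbered $b$ are joined by a tunnel. Put $\Theta=\Phi^{-1}\circ\Psi$. **Theorem.** For every $n$, $\Theta$ is a bijection from $S_n(321)$ to $S_n(132)$, and $\Theta$ and $\Theta^{-1}$ satisfy the following recursions. (1) Let $\sigma\in S_n(321)$. If $n=1$, then $\Theta(\sigma)=\sigma$. If $n>1$, let $k=\sigma(n)$, let $\pi=\mathrm{red}(\sigma(1)\cdots\sigma(n-1))$, and let $j-1$ be the number of matched excedance values of $\sigma$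 that are less than $k$. Then $\pi\in S_{n-1}(321)$, $\sigma=\pi^{(n,k)}$, the number of matched excedance values of $\pi$ that are less than $k$ is also $j-1$, and $$\Theta(\sigma)=\Theta(\pi)^{(n-k+j,\;j)}.$$ Furthermore, $n-k+j$ is the smallest non-excedance of $\Theta(\sigma)$. (2) Let $\alpha\in S_n(132)$. If $n=1$, then $\Theta^{-1}(\alpha)=\alpha$. If $n>1$, then $\alpha$ has a smallest non-excedance $k$, there is exactly one $\beta\in S_{n-1}$ with $\beta^{(k,\alpha(k))}=\alpha$, this $\beta$ lies in $S_{n-1}(132)$, and $$\Theta^{-1}(\alpha)=\Theta^{-1}(\beta)^{(n,\;n+\alpha(k)-k)}.$$ -/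

import Mathlib

/-!  Permutations of `[n] = {1, …, n}` are written linearly, as words `σ(1) σ(2) … σ(n)`.  -/

namespace ElizaldePak

/-- The `i`-th letter `σ(i)` of a word, for `1 ≤ i ≤ |σ|`. -/
def letter (σ : List ℕ) (i : ℕ) : ℕ := σ.getD (i - 1) 0

/-- `S n`: the words that contain each of `1, …, n` exactly once. -/
def S (n : ℕ) : Set (List ℕ) := {σ | σ.Perm (List.range' 1 n)}

/-- Reduction of a word with distinct letters: each letter is replaced by its position in the
increasing rearrangement of the word. -/
def red (w : List ℕ) : List ℕ := w.map fun x => w.countP fun y => y ≤ x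

/-- Some subsequence of `σ` is an occurrence of `τ`. -/
def Contains (σ τ : List ℕ) : Prop := ∃ u : List ℕ, u.Sublist σ ∧ red u = τ

/-- `S_n(τ)`: the permutations of `[n]` that avoid `τ`. -/
def Av (n : ℕ) (τ : List ℕ) : Set (List ℕ) := {σ | σ ∈ S n ∧ ¬ Contains σ τ}

/-- `σ^{a ⋊ b}`: add `b` to all letters greater than or equal to `a`. -/
def shiftFrom (a b : ℕ) (σ : List ℕ) : List ℕ := σ.map fun x => if a ≤ x then x + b else x

/-- `σ^{(a,b)}`: insert the number `b` at the `a`-th position, for `1 ≤ a, b ≤ |σ| + 1`. -/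
def ins (σ : List ℕ) (a b : ℕ) : List ℕ :=
  (shiftFrom b 1 σ).take (a - 1) ++ b :: (shiftFrom b 1 σ).drop (a - 1)

/-- The indices `i` with `σ(i) > i`, in increasing order. -/
def excedances (σ : List ℕ) : List ℕ :=
  (List.range' 1 σ.length).filter fun i => i < letter σ i

/-- The indices `i` with `σ(i) ≤ i`, in increasing order. -/
def nonExcedances (σ : List ℕ) : List ℕ :=
  (List.range' 1 σ.length).filter fun i => letter σ i ≤ i

/-- The loop of the matching algorithm; the two lists are the excedances `e_p, e_{p+1}, …` and the
non-excedances `a_q, a_{q+1}, …` that have not been processed yet. -/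
def matchLoop (σ : List ℕ) : List ℕ → List ℕ → List (ℕ × ℕ)
  | [], _ => []
  | _ :: _, [] => []
  | e :: es, a :: as =>
    if a < e then matchLoop σ (e :: es) as
    else if letter σ e < letter σ a then matchLoop σ es (a :: as)
    else (letter σ e, a) :: matchLoop σ es as
  termination_by es as => es.length + as.length

/-- The output of the matching algorithm: pairs (matched excedance value, non-excedance). -/
def matching (σ : List ℕ) : List (ℕ × ℕ) := matchLoop σ (excedances σ) (nonExcedances σ)

/-- The number of matched excedance values of `σ` that are less than `k`. -/
def matchedBelow (σ : List ℕ) (k : ℕ) : ℕ := (matching σ).countP fun m => m.1 < k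

/-- Row insertion of `x` into a row: `x` replaces the leftmost larger entry, which is returned as
the bumped entry, or is placed at the end if there is no larger entry. -/
def rowInsert (x : ℕ) : List ℕ → List ℕ × Option ℕ
  | [] => ([x], none)
  | y :: r =>
    if x < y then (x :: r, some y)
    else (y :: (rowInsert x r).1, (rowInsert x r).2)

/-- Insertion of `x` into a tableau (the list of its rows, the first row first).  The second
component is the index (from `0`) of the row that has become longer. -/
def tableauInsert (x : ℕ) : List (List ℕ) → List (List ℕ) × ℕ
  | [] => ([[x]], 0)
  | r :: T =>
    match rowInsert x r with
    | (r', none) => (r' :: T, 0)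
    | (r', some y) => (r' :: (tableauInsert y T).1, (tableauInsert y T).2 + 1)

/-- Place `x` at the end of the row of index `i`, which may be a new row. -/
def addToRow (x : ℕ) : ℕ → List (List ℕ) → List (List ℕ)
  | _, [] => [[x]]
  | 0, r :: T => (r ++ [x]) :: T
  | i + 1, r :: T => r :: addToRow x i T

/-- One step of the Robinson–Schensted algorithm: insert `(i, x)` into `(P, Q)`. -/
def rskStep (PQ : List (List ℕ) × List (List ℕ)) (ix : ℕ × ℕ) :
    List (List ℕ) × List (List ℕ) :=
  ((tableauInsert ix.2 PQ.1).1, addToRow ix.1 (tableauInsert ix.2 PQ.1).2 PQ.2)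

/-- The Robinson–Schensted correspondence: insert `(1, σ(1)), (2, σ(2)), …` in this order.
The result is the pair (insertion tableau, recording tableau). -/
def rsk (σ : List ℕ) : List (List ℕ) × List (List ℕ) :=
  ((List.range' 1 σ.length).zip σ).foldl rskStep ([], [])

/-- The word `Ψ(σ)` for a 321-avoiding `σ`.  Left half: for `i = 1, …, n` an up-step if `i` is in
the first row of `P` and a down-step otherwise.  Right half: for `i = n, …, 1` a down-step if `i` is
in the first row of `Q` and an up-step otherwise. -/
def Psi (σ : List ℕ) : List DyckStep :=
  ((List.range' 1 σ.length).map fun i =>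
    if i ∈ (rsk σ).1.headD [] then DyckStep.U else DyckStep.D) ++
  ((List.range' 1 σ.length).reverse.map fun i =>
    if i ∈ (rsk σ).2.headD [] then DyckStep.D else DyckStep.U)

/-- `w` is the word of a Dyck path. -/
def IsDyck (w : List DyckStep) : Prop := ∃ p : DyckWord, p.toList = w

/-- There is a tunnel of `w` from the `i`-th up-step to the `j`-th down-step, that is, a
decomposition `w = A u B d C` with `B` and `A C` Dyck words, where the displayed `u` is the `i`-th
up-step and the displayed `d` the `j`-th down-step of `w`. -/
def IsTunnel (w : List DyckStep) (i j : ℕ) : Prop :=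
  ∃ A B C : List DyckStep, w = A ++ DyckStep.U :: (B ++ DyckStep.D :: C) ∧
    IsDyck B ∧ IsDyck (A ++ C) ∧
    i = A.count DyckStep.U + 1 ∧ j = (A ++ B).count DyckStep.D + 1

/-- `Φ⁻¹(w)` for a Dyck word `w` of semi-length `n`: up-steps are numbered from `n` down to `1`,
down-steps from `1` up to `n`, and the letter of index `a` is the number `j` of the down-step at
which the tunnel from the up-step with number `a` (the `(n + 1 - a)`-th up-step) ends. -/
noncomputable def PhiInv (w : List DyckStep) : List ℕ :=
  (List.range' 1 (w.count DyckStep.U)).map fun a =>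
    sInf {j | IsTunnel w (w.count DyckStep.U + 1 - a) j}

/-- The map `Θ = Φ⁻¹ ∘ Ψ` of Elizalde and Pak on 321-avoiding permutations. -/
noncomputable def Theta (σ : List ℕ) : List ℕ := PhiInv (Psi σ)

/-- `Θ⁻¹`: the inverse of `Θ` as a map from `S(321) = ⋃ n, S_n(321)`. -/
noncomputable def ThetaInv : List ℕ → List ℕ :=
  Function.invFunOn Theta (⋃ n, Av n [3, 2, 1])

end ElizaldePak

namespace ElizaldePak

/-! Both recursions describe one operation on Dyck paths: inserting a peak that becomes the last
peak whose up-step lies in the left half.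

On the 321 side, let `k` be the last letter of `σ` and `π` the reduced rest. Avoidance forces the
letters `≥ k` of `π` to be in increasing order, which by `increasing_from_iff` means that, from
letter `k` on, the left half of `Psi π` consists of down-steps followed by up-steps. Appending `k`
puts `k` in the first row and bumps the least first-row letter above it, if there is one. On the
path this is the insertion of a peak after `k - 1` steps (`Psi_ins`).

On the 132 side, inserting a peak between `X` and `Y` inserts the letter `X.count D + 1` at position
`Y.count U + 1` (`PhiInv_peak`), and the last peak of the left half gives the smallest non-excedance
(`isLeast_nonExcedances`). The matching algorithm simulates row insertion, so the matched values are
the letters outside the first row (`matching_perm`). Hence `X.count D` is the number of matched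
values below `k`, and the recursion for `Theta` follows (`Theta_ins`).

Injectivity: the smallest non-excedance and its letter determine `k`, so induction applies.
Surjectivity: `Psi` reaches every Dyck word by removing last peaks (`exists_Psi_eq`), and `PhiInv`
reaches every 132-avoider by removing the letter 1 (`exists_PhiInv_eq`). The recursion for the
inverse is the first one read backwards. -/

/-! ### Patterns of length three and the insertion of a letter -/

theorem triple_sublist_iff {w : List ℕ} {x y z : ℕ} : [x, y, z].Sublist w ↔
    ∃ i j k : ℕ, i < j ∧ j < k ∧ w[i]? = some x ∧ w[j]? = some y ∧ w[k]? = some z := by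
  rw [List.sublist_iff_exists_orderEmbedding_getElem?_eq]
  constructor
  · rintro ⟨f, hf⟩
    refine ⟨f 0, f 1, f 2, f.strictMono (by norm_num), f.strictMono (by norm_num), ?_, ?_, ?_⟩
    · simpa using (hf 0).symm
    · simpa using (hf 1).symm
    · simpa using (hf 2).symm
  · rintro ⟨i, j, k, hij, hjk, hi, hj, hk⟩
    have hk' : k < w.length := by
      by_contra h
      simp [List.getElem?_eq_none (not_lt.1 h)] at hk
    -- The embedding must be defined on all of `ℕ`; from index 3 on it points beyond the end of `w`,
    -- so that both sides are `none`.
    refine ⟨OrderEmbedding.ofStrictMono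
      (fun m => if m = 0 then i else if m = 1 then j else if m = 2 then k else w.length + m)
      ?_, ?_⟩
    · refine strictMono_nat_of_lt_succ fun m => ?_
      rcases m with _ | _ | _ | m
      · simpa using hij
      · simpa using hjk
      · simp; omega
      · simp
    · intro m
      rcases m with _ | _ | _ | m
      · simp [hi]
      · simp [hj]
      · simp [hk]
      · simp [OrderEmbedding.ofStrictMono]

theorem contains_321_iff {w : List ℕ} : Contains w [3, 2, 1] ↔
    ∃ x y z, [x, y, z].Sublist w ∧ z < y ∧ y < x := by
  constructor
  · rintro ⟨u, hu, hr⟩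
    have hl : u.length = 3 := by simpa [red] using congrArg List.length hr
    obtain ⟨x, y, z, rfl⟩ := List.length_eq_three.1 hl
    refine ⟨x, y, z, hu, ?_⟩
    simp only [red, List.map_cons, List.map_nil, List.countP_cons, List.countP_nil,
      decide_eq_true_eq, List.cons.injEq, and_true] at hr
    obtain ⟨h1, h2, h3⟩ := hr
    split_ifs at h1 h2 h3 <;> omega
  · rintro ⟨x, y, z, hu, h1, h2⟩
    refine ⟨[x, y, z], hu, ?_⟩
    simp [red, List.countP_cons, h1.le, h2.le, (h1.trans h2).le, h1.not_ge, h2.not_ge,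
      (h1.trans h2).not_ge]

theorem contains_132_iff {w : List ℕ} : Contains w [1, 3, 2] ↔
    ∃ x y z, [x, y, z].Sublist w ∧ x < z ∧ z < y := by
  constructor
  · rintro ⟨u, hu, hr⟩
    have hl : u.length = 3 := by simpa [red] using congrArg List.length hr
    obtain ⟨x, y, z, rfl⟩ := List.length_eq_three.1 hl
    refine ⟨x, y, z, hu, ?_⟩
    simp only [red, List.map_cons, List.map_nil, List.countP_cons, List.countP_nil,
      decide_eq_true_eq, List.cons.injEq, and_true] at hr
    obtain ⟨h1, h2, h3⟩ := hr
    split_ifs at h1 h2 h3 <;> omega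
  · rintro ⟨x, y, z, hu, h1, h2⟩
    refine ⟨[x, y, z], hu, ?_⟩
    simp [red, List.countP_cons, h1.le, h2.le, (h1.trans h2).le, h1.not_ge, h2.not_ge,
      (h1.trans h2).not_ge]

theorem mem_S_iff {n : ℕ} {w : List ℕ} :
    w ∈ S n ↔ w.Nodup ∧ ∀ x, x ∈ w ↔ 1 ≤ x ∧ x ≤ n := by
  constructor
  · intro (h : w.Perm (List.range' 1 n))
    refine ⟨h.nodup_iff.2 List.nodup_range', fun x => ?_⟩
    rw [h.mem_iff, List.mem_range'_1]
    omega
  · rintro ⟨h1, h2⟩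
    refine (List.perm_ext_iff_of_nodup h1 List.nodup_range').2 fun x => ?_
    rw [h2, List.mem_range'_1]
    omega

theorem length_of_mem_S {n : ℕ} {w : List ℕ} (h : w ∈ S n) : w.length = n := by
  simpa using List.Perm.length_eq h

/-- The one-letter shift `x ↦ x + 1` for `x ≥ b` that is used by `ins`. -/
def shiftLetter (b x : ℕ) : ℕ := if b ≤ x then x + 1 else x

/-- The left inverse of `shiftLetter b`. -/
def unshiftLetter (b x : ℕ) : ℕ := if x < b then x else x - 1

theorem shiftLetter_strictMono (b : ℕ) : StrictMono (shiftLetter b) := by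
  intro x y h
  unfold shiftLetter
  split_ifs <;> omega

theorem shiftLetter_ne (b x : ℕ) : shiftLetter b x ≠ b := by
  unfold shiftLetter
  split_ifs <;> omega

theorem unshiftLetter_shiftLetter (b x : ℕ) : unshiftLetter b (shiftLetter b x) = x := by
  unfold shiftLetter unshiftLetter
  split_ifs <;> omega

theorem shiftLetter_unshiftLetter {b x : ℕ} (h : x ≠ b) :
    shiftLetter b (unshiftLetter b x) = x := by
  unfold shiftLetter unshiftLetter
  split_ifs <;> omega

theorem shiftFrom_eq_map (b : ℕ) (w : List ℕ) : shiftFrom b 1 w = w.map (shiftLetter b) := rfl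

theorem ins_append (s t : List ℕ) (b : ℕ) :
    ins (s ++ t) (s.length + 1) b = s.map (shiftLetter b) ++ b :: t.map (shiftLetter b) := by
  simp [ins, shiftFrom_eq_map]

theorem ins_length_add_one {w : List ℕ} {n b : ℕ} (h : w.length + 1 = n) :
    ins w n b = w.map (shiftLetter b) ++ [b] := by
  have := ins_append w [] b
  simpa [h] using this

theorem ins_perm (w : List ℕ) (a b : ℕ) : (ins w a b).Perm (b :: w.map (shiftLetter b)) := by
  unfold ins
  refine List.perm_middle.trans ?_
  rw [List.take_append_drop, shiftFrom_eq_map]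

theorem ins_mem_S {n a b : ℕ} {w : List ℕ} (hw : w ∈ S n) (h1 : 1 ≤ b) (h2 : b ≤ n + 1) :
    ins w a b ∈ S (n + 1) := by
  rw [mem_S_iff] at hw ⊢
  refine ⟨(ins_perm w a b).nodup_iff.2 (List.nodup_cons.2 ⟨?_, ?_⟩), fun x => ?_⟩
  · simp only [List.mem_map, not_exists, not_and]
    exact fun x _ => shiftLetter_ne b x
  · exact hw.1.map (shiftLetter_strictMono b).injective
  · rw [(ins_perm w a b).mem_iff]
    simp only [List.mem_cons, List.mem_map, hw.2]
    constructor
    · rintro (rfl | ⟨y, hy, rfl⟩)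
      · omega
      · unfold shiftLetter
        split_ifs <;> omega
    · intro hx
      by_cases hxb : x = b
      · exact Or.inl hxb
      · refine Or.inr ⟨unshiftLetter b x, ?_, shiftLetter_unshiftLetter hxb⟩
        unfold unshiftLetter
        split_ifs <;> omega

theorem getElem?_ins {w : List ℕ} {a b i : ℕ} (h2 : a ≤ w.length) :
    (ins w (a + 1) b)[i]? = if i < a then (w[i]?).map (shiftLetter b) else
      if i = a then some b else (w[i - 1]?).map (shiftLetter b) := by
  have : w = w.take a ++ w.drop a := (List.take_append_drop a w).symm
  have hl : (w.take a).length = a := by simp [h2]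
  have key := ins_append (w.take a) (w.drop a) b
  rw [List.take_append_drop, hl] at key
  rw [key]
  split_ifs with h h'
  · rw [List.getElem?_append_left (by simpa [h2] using h), List.getElem?_map,
      List.getElem?_take_of_lt h]
  · subst h'
    rw [List.getElem?_append_right (by simp [h2])]
    simp [h2]
  · rw [List.getElem?_append_right (by simp; omega)]
    have : i - ((w.take a).map (shiftLetter b)).length = (i - 1 - a) + 1 := by
      simp [h2]; omega
    rw [this, List.getElem?_cons_succ, List.getElem?_map, List.getElem?_drop]
    congr 2
    omega

theorem ins_injective {w w' : List ℕ} {a b : ℕ} (hl : w.length = w'.length)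
    (h2 : a ≤ w.length) (h : ins w (a + 1) b = ins w' (a + 1) b) : w = w' := by
  have hm : Function.Injective (Option.map (shiftLetter b)) :=
    Option.map_injective (shiftLetter_strictMono b).injective
  apply List.ext_getElem?
  intro i
  by_cases hi : i < a
  · have := congrArg (fun l => l[i]?) h
    simp only [getElem?_ins h2, getElem?_ins (hl ▸ h2), hi, if_true] at this
    exact hm this
  · have := congrArg (fun l => l[i + 1]?) h
    simp only [getElem?_ins h2, getElem?_ins (hl ▸ h2), show ¬ i + 1 < a by omega,
      show ¬ i + 1 = a by omega, if_false, Nat.add_sub_cancel] at this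
    exact hm this

theorem map_shiftLetter_map_unshiftLetter {b : ℕ} {w : List ℕ} (h : b ∉ w) :
    (w.map (unshiftLetter b)).map (shiftLetter b) = w := by
  rw [List.map_map]
  conv_rhs => rw [← List.map_id w]
  refine List.map_congr_left fun x hx => ?_
  exact shiftLetter_unshiftLetter (by rintro rfl; exact h hx)

theorem unshift_mem_S {n b : ℕ} {s t : List ℕ} (h : s ++ b :: t ∈ S (n + 1)) :
    (s ++ t).map (unshiftLetter b) ∈ S n := by
  rw [mem_S_iff] at h ⊢
  obtain ⟨h1, h2⟩ := h
  have h3 : (b :: (s ++ t)).Nodup := List.perm_middle.nodup_iff.1 h1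
  obtain ⟨hb, h3⟩ := List.nodup_cons.1 h3
  have h4 : ∀ x, x ∈ s ++ t ↔ (1 ≤ x ∧ x ≤ n + 1) ∧ x ≠ b := by
    intro x
    constructor
    · intro hx
      refine ⟨(h2 x).1 (List.perm_middle.mem_iff.2 (List.mem_cons_of_mem _ hx)), ?_⟩
      rintro rfl
      exact hb hx
    · rintro ⟨hx, hxb⟩
      have := List.perm_middle.mem_iff.1 ((h2 x).2 hx)
      simpa [hxb] using this
  have hb' := (h2 b).1 (by simp)
  constructor
  · refine h3.map_on fun x hx y hy hxy => ?_
    rw [h4] at hx hy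
    have := congrArg (shiftLetter b) hxy
    rwa [shiftLetter_unshiftLetter hx.2, shiftLetter_unshiftLetter hy.2] at this
  · intro x
    simp only [List.mem_map, h4]
    constructor
    · rintro ⟨y, hy, rfl⟩
      unfold unshiftLetter
      split_ifs <;> omega
    · intro hx
      refine ⟨shiftLetter b x, ⟨?_, shiftLetter_ne b x⟩, unshiftLetter_shiftLetter b x⟩
      unfold shiftLetter
      split_ifs <;> omega

theorem not_contains_321_of_map {f : ℕ → ℕ} (hf : StrictMono f) {v w : List ℕ}
    (h : (v.map f).Sublist w) (hw : ¬ Contains w [3, 2, 1]) : ¬ Contains v [3, 2, 1] := by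
  rw [contains_321_iff] at *
  rintro ⟨x, y, z, hs, h1, h2⟩
  exact hw ⟨f x, f y, f z, (hs.map f).trans h, hf h1, hf h2⟩

theorem not_contains_132_of_map {f : ℕ → ℕ} (hf : StrictMono f) {v w : List ℕ}
    (h : (v.map f).Sublist w) (hw : ¬ Contains w [1, 3, 2]) : ¬ Contains v [1, 3, 2] := by
  rw [contains_132_iff] at *
  rintro ⟨x, y, z, hs, h1, h2⟩
  exact hw ⟨f x, f y, f z, (hs.map f).trans h, hf h1, hf h2⟩

theorem countP_le_range' (x n : ℕ) :
    (List.range' 1 n).countP (fun y => y ≤ x) = min x n := by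
  induction n with
  | zero => simp
  | succ n ih =>
    rw [List.range'_1_concat, List.countP_append, ih]
    simp only [List.countP_cons, List.countP_nil, decide_eq_true_eq]
    split_ifs <;> omega

/-- In the whole permutation the rank of `x` is `x` itself; leaving out `k` lowers it by one exactly
when `k < x`. -/
theorem red_of_concat_mem_S {n k : ℕ} {s : List ℕ} (h : s ++ [k] ∈ S n) :
    red s = s.map (unshiftLetter k) := by
  unfold red
  refine List.map_congr_left fun x hx => ?_
  have hp : (s ++ [k]).Perm (List.range' 1 n) := h
  have h1 := hp.countP_eq (fun y => decide (y ≤ x))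
  rw [countP_le_range', List.countP_append] at h1
  have hx' := ((mem_S_iff.1 h).2 x).1 (by simp [hx])
  have hne : x ≠ k := by
    rintro rfl
    have := (mem_S_iff.1 h).1
    simp [List.nodup_append] at this
    exact this.2 _ hx rfl
  simp only [List.countP_cons, List.countP_nil, decide_eq_true_eq] at h1
  unfold unshiftLetter
  split_ifs at h1 ⊢ <;> omega

theorem letter_eq {w : List ℕ} {i x : ℕ} (h : w[i]? = some x) : letter w (i + 1) = x := by
  simp [letter, List.getD, h]

theorem letter_append_cons (s t : List ℕ) (x : ℕ) : letter (s ++ x :: t) (s.length + 1) = x :=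
  letter_eq (by simp)

/-! ### First rows of the two tableaux when a letter is appended -/

/-- The first row of the insertion tableau. -/
def firstRow (w : List ℕ) : List ℕ := (rsk w).1.headD []

/-- The first row of the recording tableau. -/
def recRow (w : List ℕ) : List ℕ := (rsk w).2.headD []

theorem rowInsert_cases (x : ℕ) (r : List ℕ) :
    ((∀ y ∈ r, y ≤ x) ∧ rowInsert x r = (r ++ [x], none)) ∨
    ∃ r₀ y r₁, r = r₀ ++ y :: r₁ ∧ (∀ z ∈ r₀, z ≤ x) ∧ x < y ∧
      rowInsert x r = (r₀ ++ x :: r₁, some y) := by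
  induction r with
  | nil => left; simp [rowInsert]
  | cons a r ih =>
    by_cases h : x < a
    · right
      exact ⟨[], a, r, rfl, by simp, h, by simp [rowInsert, h]⟩
    · rcases ih with ⟨h1, h2⟩ | ⟨r₀, y, r₁, h1, h2, h3, h4⟩
      · left
        refine ⟨?_, by simp [rowInsert, h, h2]⟩
        simpa using ⟨not_lt.1 h, h1⟩
      · right
        refine ⟨a :: r₀, y, r₁, by simp [h1], ?_, h3, by simp [rowInsert, h, h4]⟩
        simpa using ⟨not_lt.1 h, h2⟩

theorem rowInsert_map {f : ℕ → ℕ} (hf : StrictMono f) (x : ℕ) (r : List ℕ) :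
    rowInsert (f x) (r.map f) = ((rowInsert x r).1.map f, (rowInsert x r).2.map f) := by
  induction r with
  | nil => simp [rowInsert]
  | cons a r ih =>
    simp only [List.map_cons, rowInsert, hf.lt_iff_lt, ih]
    split_ifs <;> simp

theorem rsk_concat (w : List ℕ) (x : ℕ) :
    rsk (w ++ [x]) = rskStep (rsk w) (w.length + 1, x) := by
  unfold rsk
  rw [List.length_append, List.length_singleton, List.range'_1_concat,
    List.zip_append (by simp), List.foldl_append]
  simp [Nat.add_comm]

theorem firstRow_concat (w : List ℕ) (x : ℕ) :
    firstRow (w ++ [x]) = (rowInsert x (firstRow w)).1 := by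
  unfold firstRow
  rw [rsk_concat]
  rcases h : (rsk w).1 with _ | ⟨r, T⟩
  · simp [rskStep, h, tableauInsert, rowInsert]
  · rcases h' : rowInsert x r with ⟨r', _ | y⟩ <;> simp [rskStep, h, tableauInsert, h']

/-- On an empty tableau `addToRow` opens the first row whatever the index is; this excludes that
case in `recRow_concat`. -/
theorem rsk_snd_ne_nil (w : List ℕ) (hw : w ≠ []) : (rsk w).2 ≠ [] := by
  induction w using List.reverseRecOn with
  | nil => exact absurd rfl hw
  | append_singleton w x _ =>
    rw [rsk_concat]
    simp only [rskStep]
    rcases (rsk w).2 with _ | ⟨r, T⟩ <;> rcases (tableauInsert x (rsk w).1).2 with _ | i <;>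
      simp [addToRow]

theorem rsk_fst_ne_nil (w : List ℕ) (hw : w ≠ []) : (rsk w).1 ≠ [] := by
  induction w using List.reverseRecOn with
  | nil => exact absurd rfl hw
  | append_singleton w x _ =>
    rw [rsk_concat]
    simp only [rskStep]
    rcases (rsk w).1 with _ | ⟨r, T⟩
    · simp [tableauInsert]
    · rcases h' : rowInsert x r with ⟨r', _ | y⟩ <;> simp [tableauInsert, h']

theorem recRow_concat (w : List ℕ) (x : ℕ) :
    recRow (w ++ [x]) = if (rowInsert x (firstRow w)).2 = none then recRow w ++ [w.length + 1]
      else recRow w := by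
  unfold recRow firstRow
  rcases eq_or_ne w [] with rfl | hw
  · rfl
  rw [rsk_concat]
  obtain ⟨r, T, h⟩ := List.exists_cons_of_ne_nil (rsk_fst_ne_nil w hw)
  obtain ⟨q, T', h1⟩ := List.exists_cons_of_ne_nil (rsk_snd_ne_nil w hw)
  rcases h' : rowInsert x r with ⟨r', _ | y⟩ <;>
    simp [rskStep, h, tableauInsert, h', h1, addToRow]

theorem firstRow_map {f : ℕ → ℕ} (hf : StrictMono f) (w : List ℕ) :
    firstRow (w.map f) = (firstRow w).map f := by
  induction w using List.reverseRecOn with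
  | nil => rfl
  | append_singleton w x ih =>
    rw [List.map_append, List.map_singleton, firstRow_concat, firstRow_concat, ih,
      rowInsert_map hf]

theorem recRow_map {f : ℕ → ℕ} (hf : StrictMono f) (w : List ℕ) :
    recRow (w.map f) = recRow w := by
  induction w using List.reverseRecOn with
  | nil => rfl
  | append_singleton w x ih =>
    rw [List.map_append, List.map_singleton, recRow_concat, recRow_concat, ih,
      firstRow_map hf, rowInsert_map hf]
    simp

theorem mem_of_mem_firstRow {w : List ℕ} {y : ℕ} (h : y ∈ firstRow w) : y ∈ w := by
  induction w using List.reverseRecOn with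
  | nil => exact h
  | append_singleton w x ih =>
    rw [firstRow_concat] at h
    rcases rowInsert_cases x (firstRow w) with ⟨_, h2⟩ | ⟨r₀, z, r₁, h1, _, _, h4⟩
    · rw [h2] at h
      simp only [List.mem_append] at h ⊢
      exact h.imp_left ih
    · rw [h4] at h
      rw [h1] at ih
      simp only [List.mem_append, List.mem_cons, List.not_mem_nil, or_false] at h ih ⊢
      tauto

theorem mem_recRow_le {w : List ℕ} {y : ℕ} (h : y ∈ recRow w) : y ≤ w.length := by
  induction w using List.reverseRecOn with
  | nil => simp [recRow, rsk] at h
  | append_singleton w x ih =>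
    rw [recRow_concat] at h
    simp only [List.length_append, List.length_singleton]
    split_ifs at h
    · simp only [List.mem_append, List.mem_singleton] at h
      rcases h with h | h
      · have := ih h
        omega
      · omega
    · have := ih h
      omega

theorem firstRow_pairwise {w : List ℕ} (hw : w.Nodup) : (firstRow w).Pairwise (· < ·) := by
  induction w using List.reverseRecOn with
  | nil => exact List.Pairwise.nil
  | append_singleton w x ih =>
    rw [List.nodup_append] at hw
    have hx : ∀ y ∈ firstRow w, y ≠ x := fun y hy =>
      hw.2.2 y (mem_of_mem_firstRow hy) x (by simp)
    have ih := ih hw.1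
    rw [firstRow_concat]
    rcases rowInsert_cases x (firstRow w) with ⟨h1, h2⟩ | ⟨r₀, z, r₁, h1, h2, h3, h4⟩
    · rw [h2]
      refine List.pairwise_append.2 ⟨ih, List.pairwise_singleton _ _, ?_⟩
      intro y hy z hz
      rw [List.mem_singleton.1 hz]
      exact lt_of_le_of_ne (h1 y hy) (hx y hy)
    · rw [h4]
      rw [h1] at ih hx
      simp only [List.pairwise_append, List.pairwise_cons, List.mem_cons, List.mem_append,
        forall_eq_or_imp] at ih hx ⊢
      refine ⟨ih.1, ⟨fun a ha => h3.trans (ih.2.1.1 a ha), ih.2.1.2⟩, fun a ha => ⟨?_, ?_⟩⟩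
      · exact lt_of_le_of_ne (h2 a ha) (hx a (Or.inl ha))
      · exact (ih.2.2 a ha).2

/-- The two possible effects of appending a letter on the first row, for words without repeated
letters. -/
theorem firstRow_concat_cases {w : List ℕ} {x : ℕ} (hw : (w ++ [x]).Nodup) :
    ((∀ y ∈ firstRow w, y < x) ∧ (rowInsert x (firstRow w)).2 = none ∧
      ∀ z, z ∈ firstRow (w ++ [x]) ↔ z ∈ firstRow w ∨ z = x) ∨
    ∃ y ∈ firstRow w, x < y ∧ (∀ z ∈ firstRow w, x < z → y ≤ z) ∧
      (rowInsert x (firstRow w)).2 ≠ none ∧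
      ∀ z, z ∈ firstRow (w ++ [x]) ↔ (z ∈ firstRow w ∧ z ≠ y) ∨ z = x := by
  rw [List.nodup_append] at hw
  have hx : ∀ y ∈ firstRow w, y ≠ x := fun y hy =>
    hw.2.2 y (mem_of_mem_firstRow hy) x (by simp)
  have hs := firstRow_pairwise hw.1
  rw [firstRow_concat]
  rcases rowInsert_cases x (firstRow w) with ⟨h1, h2⟩ | ⟨r₀, y, r₁, h1, h2, h3, h4⟩
  · left
    refine ⟨fun y hy => lt_of_le_of_ne (h1 y hy) (hx y hy), by rw [h2], fun z => ?_⟩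
    simp [h2]
  · right
    rw [h4]
    rw [h1] at hx hs ⊢
    simp only [List.pairwise_append, List.pairwise_cons, List.mem_cons, List.mem_append,
        forall_eq_or_imp] at hs hx ⊢
    refine ⟨y, by simp, h3, ?_, by simp, fun z => ?_⟩
    · rintro z (hz | rfl | hz) hxz
      · exact absurd (h2 z hz) (by omega)
      · exact le_rfl
      · exact (hs.2.1.1 z hz).le
    · have ha : z ∈ r₀ → z ≠ y := fun h => ((hs.2.2 z h).1).ne
      have hb : z ∈ r₁ → z ≠ y := fun h => (hs.2.1.1 z h).ne'
      tauto

/-! ### Order of consecutive letters and membership in the first row -/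

theorem pair_sublist_concat {w : List ℕ} {a b x : ℕ} :
    [a, b].Sublist (w ++ [x]) ↔ [a, b].Sublist w ∨ (a ∈ w ∧ b = x) := by
  constructor
  · intro h
    obtain ⟨l₁, l₂, h1, h2, h3⟩ := List.sublist_append_iff.1 h
    rcases l₂ with _ | ⟨c, l₂⟩
    · left
      rw [List.append_nil] at h1
      rwa [h1]
    · have hl := h3.length_le
      obtain rfl : l₂ = [] := by
        rcases l₂ with _ | _
        · rfl
        · simp at hl
      have hc : c = x := by simpa using h3
      rcases l₁ with _ | ⟨d, _ | ⟨e, l₁⟩⟩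
      · simp at h1
      · simp only [List.singleton_append, List.cons.injEq, and_true] at h1
        right
        refine ⟨?_, h1.2.trans hc⟩
        rw [h1.1]
        simpa using h2
      · simp at h1
  · rintro (h | ⟨h, rfl⟩)
    · exact h.trans (List.sublist_append_left _ _)
    · exact (List.singleton_sublist.2 h).append (List.Sublist.refl [b])

/-- A letter that bumps `i + 1` is smaller than `i`, and would bump `i` instead if `i` were still in
the row. So `i + 1` leaves only after `i`, and bumped letters never return. -/
theorem succ_mem_firstRow {w : List ℕ} {i : ℕ} (hw : w.Nodup) (h : [i, i + 1].Sublist w)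
    (hi : i ∈ firstRow w) : i + 1 ∈ firstRow w := by
  induction w using List.reverseRecOn with
  | nil => simp at h
  | append_singleton w x ih =>
    have hw' := (List.nodup_append.1 hw).1
    have hx : ∀ y ∈ w, y ≠ x := fun y hy => (List.nodup_append.1 hw).2.2 y hy x (by simp)
    rcases pair_sublist_concat.1 h with h | ⟨h, rfl⟩
    · have h1 : i ≠ x := hx i (h.subset (by simp))
      have h2 : i + 1 ≠ x := hx (i + 1) (h.subset (by simp))
      rcases firstRow_concat_cases hw with ⟨_, _, hm⟩ | ⟨y, hy, hxy, hmin, _, hm⟩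
      · rw [hm] at hi ⊢
        exact Or.inl (ih hw' h (by tauto))
      · rw [hm] at hi ⊢
        have hi' : i ∈ firstRow w := by tauto
        refine Or.inl ⟨ih hw' h hi', ?_⟩
        rintro rfl
        have := hmin i hi' (by omega)
        omega
    · rcases firstRow_concat_cases hw with ⟨_, _, hm⟩ | ⟨y, hy, hxy, hmin, _, hm⟩ <;>
        exact (hm _).2 (Or.inr rfl)

/-- When `i` arrives, `i + 1` has left already or is the least larger entry and gets bumped. -/
theorem succ_notMem_firstRow {w : List ℕ} {i : ℕ} (hw : w.Nodup)
    (h : [i + 1, i].Sublist w) : i + 1 ∉ firstRow w := by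
  induction w using List.reverseRecOn with
  | nil => simp at h
  | append_singleton w x ih =>
    have hw' := (List.nodup_append.1 hw).1
    have hx : ∀ y ∈ w, y ≠ x := fun y hy => (List.nodup_append.1 hw).2.2 y hy x (by simp)
    rcases pair_sublist_concat.1 h with h | ⟨h, rfl⟩
    · have h2 : i + 1 ≠ x := hx (i + 1) (h.subset (by simp))
      have ih := ih hw' h
      rcases firstRow_concat_cases hw with ⟨_, _, hm⟩ | ⟨y, hy, hxy, hmin, _, hm⟩ <;>
      · rw [hm]
        tauto
    · rcases firstRow_concat_cases hw with ⟨hlt, _, hm⟩ | ⟨y, hy, hxy, hmin, _, hm⟩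
      · rw [hm]
        rintro (h | h)
        · have := hlt _ h
          omega
        · omega
      · rw [hm]
        rintro (⟨h, h'⟩ | h)
        · have := hmin _ h (by omega)
          omega
        · omega

/-- A later letter `x` bumping `i` would complete the occurrence `i + 1, i, x` of 321. -/
theorem mem_firstRow_of_succ_before {w : List ℕ} {i : ℕ} (hw : w.Nodup)
    (ha : ¬ Contains w [3, 2, 1]) (h : [i + 1, i].Sublist w) : i ∈ firstRow w := by
  induction w using List.reverseRecOn with
  | nil => simp at h
  | append_singleton w x ih =>
    have hw' := (List.nodup_append.1 hw).1
    rw [contains_321_iff] at ih ha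
    rcases pair_sublist_concat.1 h with h | ⟨h, rfl⟩
    · have ih := ih hw' (fun ⟨x, y, z, hs, hh⟩ =>
        ha ⟨x, y, z, hs.trans (List.sublist_append_left _ _), hh⟩) h
      rcases firstRow_concat_cases hw with ⟨_, _, hm⟩ | ⟨y, hy, hxy, hmin, _, hm⟩
      · exact (hm _).2 (Or.inl ih)
      · refine (hm _).2 (Or.inl ⟨ih, ?_⟩)
        rintro rfl
        exact ha ⟨i + 1, i, x, h.append (List.Sublist.refl [x]), hxy, by omega⟩
    · rcases firstRow_concat_cases hw with ⟨_, _, hm⟩ | ⟨y, hy, hxy, hmin, _, hm⟩ <;>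
        exact (hm _).2 (Or.inr rfl)

/-- In a word without repeated letters, two letters occur in one of the two orders. -/
theorem pair_sublist_total {w : List ℕ} {a b : ℕ} (ha : a ∈ w) (hb : b ∈ w) (hab : a ≠ b) :
    [a, b].Sublist w ∨ [b, a].Sublist w := by
  induction w with
  | nil => simp at ha
  | cons c w ih =>
    rcases List.mem_cons.1 ha with rfl | ha'
    · left
      exact (List.singleton_sublist.2 ((List.mem_cons.1 hb).resolve_left hab.symm)).cons_cons a
    · rcases List.mem_cons.1 hb with rfl | hb'
      · right
        exact (List.singleton_sublist.2 ha').cons_cons b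
      · exact (ih ha' hb').imp (fun h => h.cons c) (fun h => h.cons c)

theorem pair_sublist_trans {w : List ℕ} {a b c : ℕ} (hw : w.Nodup) (h1 : [a, b].Sublist w)
    (h2 : [b, c].Sublist w) : [a, c].Sublist w := by
  induction w with
  | nil => simp at h1
  | cons d w ih =>
    obtain ⟨hd, hw⟩ := List.nodup_cons.1 hw
    have hb : [a, b].Sublist w ∨ (a = d ∧ b ∈ w) := by
      rcases List.cons_sublist_cons'.1 h1 with h | ⟨h, h'⟩
      · exact Or.inl h
      · exact Or.inr ⟨h, List.singleton_sublist.1 h'⟩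
    have hbw : b ∈ w := by
      rcases hb with h | h
      · exact h.subset (by simp)
      · exact h.2
    have h2' : [b, c].Sublist w := by
      rcases List.cons_sublist_cons'.1 h2 with h | ⟨rfl, _⟩
      · exact h
      · exact absurd hbw hd
    rcases hb with h | ⟨rfl, _⟩
    · exact (ih hw h h2').cons d
    · exact (List.singleton_sublist.2 (h2'.subset (by simp))).cons_cons a

/-- For 321-avoiding permutations, the letters `≥ k` occur in increasing order if and only if the
indicator word of the first row, from `k` on, does not leave the first row. -/
theorem increasing_from_iff {n k : ℕ} {w : List ℕ} (hw : w ∈ Av n [3, 2, 1]) (hk : 1 ≤ k) :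
    (∀ x y, k ≤ y → y < x → ¬ [x, y].Sublist w) ↔
    ∀ i, k ≤ i → i + 1 ≤ n → i ∈ firstRow w → i + 1 ∈ firstRow w := by
  obtain ⟨hS, ha⟩ := hw
  obtain ⟨hnd, hmem⟩ := mem_S_iff.1 hS
  constructor
  · intro h i hki hin hi
    refine succ_mem_firstRow hnd ?_ hi
    rcases pair_sublist_total ((hmem i).2 (by omega)) ((hmem (i + 1)).2 (by omega))
      (by omega) with h' | h'
    · exact h'
    · exact absurd h' (h _ _ hki (by omega))
  · intro h
    have step : ∀ i, k ≤ i → i + 1 ≤ n → [i, i + 1].Sublist w := by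
      intro i hki hin
      rcases pair_sublist_total ((hmem i).2 (by omega)) ((hmem (i + 1)).2 (by omega))
        (by omega) with h' | h'
      · exact h'
      -- If `i + 1` preceded `i`, then `i` would be in the first row and `i + 1` outside it, against
      -- `h`.
      · exact absurd (h i hki hin (mem_firstRow_of_succ_before hnd ha h'))
          (succ_notMem_firstRow hnd h')
    have all : ∀ d y, k ≤ y → y + d + 1 ≤ n → [y, y + d + 1].Sublist w := by
      intro d
      induction d with
      | zero => exact fun y hy hn => step y hy hn
      | succ d ih =>
        intro y hy hn
        exact pair_sublist_trans hnd (ih y hy (by omega)) (step _ (by omega) (by omega))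
    intro x y hy hyx hs
    have hx : x ≤ n := ((hmem x).1 (hs.subset (by simp))).2
    have h1 := all (x - y - 1) y hy (by omega)
    rw [show y + (x - y - 1) + 1 = x by omega] at h1
    have := pair_sublist_trans hnd h1 hs
    have h2 := hnd.sublist this
    simp at h2

/-! ### Excedances of 321-avoiders and the matching algorithm -/

theorem countP_lt_range' (x n : ℕ) :
    (List.range' 1 n).countP (fun y => y < x) = min (x - 1) n := by
  induction n with
  | zero => simp
  | succ n ih =>
    rw [List.range'_1_concat, List.countP_append, ih]
    simp only [List.countP_cons, List.countP_nil, decide_eq_true_eq]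
    split_ifs <;> omega

theorem countP_lt_of_split {n x : ℕ} {u v : List ℕ} (h : u ++ x :: v ∈ S n) :
    u.countP (fun y => y < x) + v.countP (fun y => y < x) = x - 1 := by
  have hp : (u ++ x :: v).Perm (List.range' 1 n) := h
  have h1 := hp.countP_eq (fun y => decide (y < x))
  have hx := ((mem_S_iff.1 h).2 x).1 (by simp)
  rw [countP_lt_range', List.countP_append, List.countP_cons] at h1
  simp at h1
  omega

/-- A smaller letter after `x` would complete a 321, so all `x - 1` smaller letters are in `u`. -/
theorem le_of_larger_before {n x : ℕ} {u v : List ℕ} (h : u ++ x :: v ∈ Av n [3, 2, 1])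
    (hz : ∃ z ∈ u, x < z) : x ≤ u.length + 1 := by
  obtain ⟨z, hz, hxz⟩ := hz
  have h1 := countP_lt_of_split h.1
  have h2 : v.countP (fun y => y < x) = 0 := by
    rw [List.countP_eq_zero]
    intro y hy hyx
    refine h.2 (contains_321_iff.2 ⟨z, x, y, ?_, by simpa using hyx, hxz⟩)
    exact (List.singleton_sublist.2 hz).append ((List.singleton_sublist.2 hy).cons_cons x)
  have h3 : u.countP (fun y => y < x) ≤ u.length := List.countP_le_length
  omega

/-- A larger letter before `x` would complete a 321, so all of `u` is smaller than `x`, and so is at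
least one letter of `v`. -/
theorem lt_of_smaller_after {n x : ℕ} {u v : List ℕ} (h : u ++ x :: v ∈ Av n [3, 2, 1])
    (hy : ∃ y ∈ v, y < x) : u.length + 1 < x := by
  obtain ⟨y, hy, hyx⟩ := hy
  have h1 := countP_lt_of_split h.1
  have h2 : 0 < v.countP (fun y => y < x) := List.countP_pos_iff.2 ⟨y, hy, by simpa using hyx⟩
  have h3 : u.countP (fun y => y < x) = u.length := by
    rw [List.countP_eq_length]
    intro z hz
    have hne : z ≠ x := fun hzx =>
      (List.nodup_append.1 (mem_S_iff.1 h.1).1).2.2 z hz x (by simp) hzx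
    by_contra hzx
    refine h.2 (contains_321_iff.2 ⟨z, x, y, ?_, hyx, ?_⟩)
    · exact (List.singleton_sublist.2 hz).append ((List.singleton_sublist.2 hy).cons_cons x)
    · have : ¬ z < x := by simpa using hzx
      omega
  omega

theorem letter_eq_getElem {w : List ℕ} {m : ℕ} (h1 : 1 ≤ m) (h2 : m ≤ w.length) :
    letter w m = w[m - 1] := by
  obtain ⟨m, rfl⟩ := Nat.exists_eq_add_of_le' h1
  exact letter_eq (by simp)

theorem exists_split {w : List ℕ} {m : ℕ} (h1 : 1 ≤ m) (h2 : m ≤ w.length) :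
    ∃ u v, w = u ++ letter w m :: v ∧ u.length + 1 = m ∧
      (∀ a, 1 ≤ a → a < m → letter w a ∈ u) ∧
      ∀ a, m < a → a ≤ w.length → letter w a ∈ v := by
  refine ⟨w.take (m - 1), w.drop m, ?_, ?_, ?_, ?_⟩
  · rw [letter_eq_getElem h1 h2]
    conv_lhs => rw [← List.take_append_drop (m - 1) w]
    rw [List.drop_eq_getElem_cons (by omega)]
    congr 3
    omega
  · simp
    omega
  · intro a ha ham
    rw [letter_eq_getElem ha (by omega), List.mem_take_iff_getElem]
    exact ⟨a - 1, by omega, rfl⟩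
  · intro a ham ha
    rw [letter_eq_getElem (by omega) ha, List.mem_drop_iff_getElem]
    refine ⟨a - 1 - m, by omega, ?_⟩
    congr 1
    omega

theorem map_letter_range' (w : List ℕ) : (List.range' 1 w.length).map (letter w) = w := by
  apply List.ext_getElem
  · simp
  · intro i h1 h2
    simp only [List.getElem_map, List.getElem_range', one_mul]
    rw [Nat.add_comm]
    exact letter_eq (by simp)

theorem letter_inj {w : List ℕ} (hw : w.Nodup) {a m : ℕ} (ha : 1 ≤ a) (ham : a < m)
    (hm : m ≤ w.length) : letter w a ≠ letter w m := by
  rw [letter_eq_getElem ha (by omega), letter_eq_getElem (by omega) hm]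
  intro h
  have := (hw.getElem_inj_iff).1 h
  omega

/-- In a 321-avoiding permutation, an inversion consists of an excedance followed by a
non-excedance. -/
theorem letter_lt_letter {n : ℕ} {w : List ℕ} (hw : w ∈ Av n [3, 2, 1]) {a m : ℕ} (ha : 1 ≤ a)
    (ham : a < m) (hm : m ≤ n) (h : m < letter w m ∨ letter w a ≤ a) :
    letter w a < letter w m := by
  have hl := length_of_mem_S hw.1
  have hne := letter_inj (mem_S_iff.1 hw.1).1 ha ham (hl.symm ▸ hm)
  by_contra hlt
  rcases h with h | h
  · obtain ⟨u, v, h1, h2, h3, -⟩ := exists_split (w := w) (m := m) (by omega) (by omega)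
    rw [h1] at hw
    have := le_of_larger_before hw ⟨_, h3 a ha ham, by omega⟩
    omega
  · obtain ⟨u, v, h1, h2, -, h3⟩ := exists_split (w := w) (m := a) (by omega) (by omega)
    rw [h1] at hw
    have := lt_of_smaller_after hw ⟨_, h3 m ham (by omega), by omega⟩
    omega

theorem firstRow_append (u v : List ℕ) :
    firstRow (u ++ v) = v.foldl (fun r x => (rowInsert x r).1) (firstRow u) := by
  induction v using List.reverseRecOn with
  | nil => simp
  | append_singleton v x ih =>
    rw [← List.append_assoc, firstRow_concat, ih, List.foldl_append]
    rfl

theorem rowInsert_of_forall_lt {x : ℕ} {r : List ℕ} (h : ∀ y ∈ r, y < x) :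
    (rowInsert x r).1 = r ++ [x] := by
  induction r with
  | nil => rfl
  | cons a r ih =>
    simp only [List.mem_cons, forall_eq_or_imp] at h
    simp [rowInsert, h.1.le.not_gt, ih h.2]

theorem rowInsert_append_cons {x y : ℕ} {r q : List ℕ} (h : ∀ z ∈ r, z < x) (hy : x < y) :
    (rowInsert x (r ++ y :: q)).1 = r ++ x :: q := by
  induction r with
  | nil => simp [rowInsert, hy]
  | cons a r ih =>
    simp only [List.mem_cons, forall_eq_or_imp] at h
    simp [rowInsert, h.1.le.not_gt, ih h.2]

theorem matchLoop_skip (w : List ℕ) (es : List ℕ) (a : ℕ) (as : List ℕ) (h : ∀ e ∈ es, a < e) :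
    matchLoop w es (a :: as) = matchLoop w es as := by
  rcases es with _ | ⟨e, es⟩
  · rw [matchLoop, matchLoop]
  · rw [matchLoop, if_pos (h e (by simp))]

/-- The matching algorithm pairs the excedance values that are bumped from the first row with the
letters that bump them.  Here `q` is the queue of the unmatched excedances already passed, `ps` the
list of the remaining positions, and `r` the part of the first row that stays there. -/
theorem matchLoop_perm {n : ℕ} {w : List ℕ}
    (hmono : ∀ a m, 1 ≤ a → a < m → m ≤ n → (m < letter w m ∨ letter w a ≤ a) →
      letter w a < letter w m)
    (hinj : ∀ a m, 1 ≤ a → a < m → m ≤ n → letter w a ≠ letter w m) (ps : List ℕ) :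
    ∀ q r : List ℕ, (∀ m ∈ ps, 1 ≤ m ∧ m ≤ n) → ps.Pairwise (· < ·) →
      (∀ e ∈ q, 1 ≤ e) → (∀ e ∈ q, ∀ m ∈ ps, e < m) → (∀ y ∈ r, ∀ m ∈ ps, y < letter w m) →
      ((matchLoop w (q ++ ps.filter fun i => i < letter w i)
        (ps.filter fun i => letter w i ≤ i)).map Prod.fst ++
        (ps.map (letter w)).foldl (fun r x => (rowInsert x r).1) (r ++ q.map (letter w))).Perm
      (r ++ q.map (letter w) ++ ps.map (letter w)) := by
  induction ps with
  | nil =>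
    intro q r _ _ _ _ _
    cases q <;> simp [matchLoop]
  | cons m ps ih =>
    intro q r hps hpw hq1 hq hr
    obtain ⟨hm, hpw⟩ := List.pairwise_cons.1 hpw
    have hmn := hps m (by simp)
    have hps' : ∀ m ∈ ps, 1 ≤ m ∧ m ≤ n := fun a ha => hps a (List.mem_cons_of_mem _ ha)
    by_cases hexc : m < letter w m
    -- An excedance value exceeds everything before it, so it is appended to the row and its index
    -- joins the queue.
    · have h1 : ∀ y ∈ r ++ q.map (letter w), y < letter w m := by
        intro y hy
        rcases List.mem_append.1 hy with hy | hy
        · exact hr y hy m (by simp)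
        · obtain ⟨e, he, rfl⟩ := List.mem_map.1 hy
          exact hmono e m (hq1 e he) (hq e he m (by simp)) hmn.2 (Or.inl hexc)
      have := ih (q ++ [m]) r hps' hpw ?_ ?_ ?_
      · simpa [hexc, hexc.not_ge, rowInsert_of_forall_lt h1] using this
      · intro e he
        rcases List.mem_append.1 he with he | he
        · exact hq1 e he
        · rw [List.mem_singleton.1 he]
          exact hmn.1
      · intro e he a ha
        rcases List.mem_append.1 he with he | he
        · exact hq e he a (List.mem_cons_of_mem _ ha)
        · rw [List.mem_singleton.1 he]
          exact hm a ha
      · exact fun y hy a ha => hr y hy a (List.mem_cons_of_mem _ ha)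
    · have hnon : letter w m ≤ m := not_lt.1 hexc
      have hlater : ∀ a ∈ ps, letter w m < letter w a := fun a ha =>
        hmono m a hmn.1 (hm a ha) (hps' a ha).2 (Or.inr hnon)
      have hr' : ∀ r' : List ℕ, (∀ y ∈ r', ∀ a ∈ m :: ps, y < letter w a) →
          ∀ y ∈ r' ++ [letter w m], ∀ a ∈ ps, y < letter w a := by
        intro r' hr y hy a ha
        rcases List.mem_append.1 hy with hy | hy
        · exact hr y hy a (List.mem_cons_of_mem _ ha)
        · rw [List.mem_singleton.1 hy]
          exact hlater a ha
      have hf1 : (m :: ps).filter (fun i => i < letter w i) = ps.filter fun i => i < letter w i :=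
        List.filter_cons_of_neg (by simpa using hexc)
      have hf2 : (m :: ps).filter (fun i => letter w i ≤ i) =
          m :: ps.filter fun i => letter w i ≤ i :=
        List.filter_cons_of_pos (by simpa using hnon)
      rw [hf1, hf2]
      -- A non-excedance `m` runs through the queue. Queued values below `letter w m` are below all
      -- later letters too, so they can never be bumped and move to `r`. The first larger one is
      -- both matched with `m` and bumped by it. If the queue runs out, the letter is appended and
      -- `m` stays unmatched.
      induction q generalizing r with
      | nil =>
        have h1 : ∀ y ∈ r ++ [].map (letter w), y < letter w m := fun y hy =>
          hr y (by simpa using hy) m (by simp)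
        have := ih [] (r ++ [letter w m]) hps' hpw (by simp) (by simp) (hr' r hr)
        rw [List.nil_append, matchLoop_skip _ _ _ _
          (fun e he => hm e (List.mem_of_mem_filter he)), List.map_cons, List.foldl_cons,
          rowInsert_of_forall_lt h1]
        simpa using this
      | cons e q ihq =>
        have he := hq e (by simp) m (by simp)
        rw [List.cons_append, matchLoop, if_neg he.not_gt]
        split_ifs with hlt
        · have := ihq (r ++ [letter w e]) (fun a ha => hq1 a (List.mem_cons_of_mem _ ha))
            (fun a ha => hq a (List.mem_cons_of_mem _ ha)) ?_
          · simpa using this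
          · intro y hy a ha
            rcases List.mem_append.1 hy with hy | hy
            · exact hr y hy a ha
            · rw [List.mem_singleton.1 hy]
              rcases List.mem_cons.1 ha with rfl | ha
              · exact hlt
              · exact hlt.trans (hlater a ha)
        · have hne := hinj e m (hq1 e (by simp)) he hmn.2
          have := ih q (r ++ [letter w m]) hps' hpw
            (fun a ha => hq1 a (List.mem_cons_of_mem _ ha))
            (fun a ha b hb => hq a (List.mem_cons_of_mem _ ha) b (List.mem_cons_of_mem _ hb))
            (hr' r hr)
          rw [List.map_cons (f := letter w) (l := q), List.map_cons (f := letter w) (l := ps),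
            List.foldl_cons, rowInsert_append_cons (fun y hy => hr y hy m (by simp)) (by omega)]
          simp only [List.map_cons, List.cons_append, List.append_assoc, List.nil_append] at this ⊢
          refine (this.cons (letter w e)).trans ?_
          refine List.perm_middle.symm.trans ?_
          refine List.Perm.append_left _ ?_
          refine ((List.Perm.cons (letter w e) List.perm_middle.symm)).trans ?_
          simp

theorem matching_perm {n : ℕ} {w : List ℕ} (hw : w ∈ Av n [3, 2, 1]) :
    ((matching w).map Prod.fst ++ firstRow w).Perm w := by
  have hl := length_of_mem_S hw.1
  have := matchLoop_perm (n := n) (w := w)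
    (fun a m ha ham hm h => letter_lt_letter hw ha ham hm h)
    (fun a m ha ham hm => letter_inj (mem_S_iff.1 hw.1).1 ha ham (hl.symm ▸ hm))
    (List.range' 1 w.length) [] [] ?_ List.pairwise_lt_range' (by simp) (by simp) (by simp)
  · simp only [map_letter_range', List.map_nil, List.append_nil, List.nil_append] at this
    have h2 := firstRow_append [] w
    rw [List.nil_append] at h2
    rw [h2]
    exact this
  · intro m hm
    rw [List.mem_range'_1] at hm
    omega

/-- The matched excedance values are the letters that are not in the first row. -/
theorem matchedBelow_eq {n k : ℕ} {w : List ℕ} (hw : w ∈ Av n [3, 2, 1]) (hk : k ≤ n + 1) :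
    matchedBelow w k = (List.range' 1 (k - 1)).countP (fun i => i ∉ firstRow w) := by
  have hp := matching_perm hw
  have hS := mem_S_iff.1 hw.1
  have hnd := hp.nodup_iff.2 hS.1
  obtain ⟨h1, h2, h3⟩ := List.nodup_append.1 hnd
  have h4 : matchedBelow w k = ((matching w).map Prod.fst).countP (fun i => i < k) := by
    rw [List.countP_map]
    rfl
  rw [h4, List.countP_eq_length_filter, List.countP_eq_length_filter]
  apply List.Perm.length_eq
  rw [List.perm_ext_iff_of_nodup (h1.filter _) (List.Nodup.filter _ List.nodup_range')]
  intro i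
  have h5 := hp.mem_iff (a := i)
  rw [hS.2, List.mem_append] at h5
  have h6 : i ∈ (matching w).map Prod.fst → i ∉ firstRow w := fun ha hb => h3 i ha i hb rfl
  simp only [List.mem_filter, List.mem_range'_1, decide_eq_true_eq]
  constructor
  · rintro ⟨ha, hb⟩
    have := h5.1 (Or.inl ha)
    exact ⟨by omega, h6 ha⟩
  · rintro ⟨ha, hb⟩
    have := h5.2 (by omega)
    exact ⟨this.resolve_right hb, by omega⟩

/-! ### The path of a 321-avoider when a last letter is inserted -/

theorem mem_map_shiftLetter_of_lt {k i : ℕ} {r : List ℕ} (h : i < k) :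
    i ∈ r.map (shiftLetter k) ↔ i ∈ r := by
  have : shiftLetter k i = i := by simp [shiftLetter, h]
  conv_lhs => rw [← this]
  exact List.mem_map_of_injective (shiftLetter_strictMono k).injective

theorem succ_mem_map_shiftLetter {k i : ℕ} {r : List ℕ} (h : k ≤ i) :
    i + 1 ∈ r.map (shiftLetter k) ↔ i ∈ r := by
  have : shiftLetter k i = i + 1 := by simp [shiftLetter, h]
  rw [← this]
  exact List.mem_map_of_injective (shiftLetter_strictMono k).injective

theorem notMem_map_shiftLetter {k : ℕ} {r : List ℕ} : k ∉ r.map (shiftLetter k) := by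
  simp only [List.mem_map, not_exists, not_and]
  exact fun x _ => shiftLetter_ne k x

/-- If `π^{(n+1,k)}` avoids 321, then the letters `≥ k` of `π` are in increasing order. -/
theorem increasing_of_ins {k : ℕ} {w : List ℕ}
    (h : ¬ Contains (w.map (shiftLetter k) ++ [k]) [3, 2, 1]) (x y : ℕ) (hk : k ≤ y)
    (hyx : y < x) : ¬ [x, y].Sublist w := by
  intro hs
  refine h (contains_321_iff.2 ⟨x + 1, y + 1, k, ?_, by omega, by omega⟩)
  have h1 := hs.map (shiftLetter k)
  simp only [List.map_cons, List.map_nil, shiftLetter, hk, hk.trans hyx.le, if_true] at h1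
  exact h1.append (List.Sublist.refl [k])

/-- The effect on the first rows of passing from `π` to `π^{(n+1,k)}`. -/
theorem firstRow_ins {n k : ℕ} {w : List ℕ} (hw : w ∈ Av n [3, 2, 1]) (hk1 : 1 ≤ k)
    (hinc : ∀ x y, k ≤ y → y < x → ¬ [x, y].Sublist w) :
    (∀ i, i < k → (i ∈ firstRow (w.map (shiftLetter k) ++ [k]) ↔ i ∈ firstRow w)) ∧
    k ∈ firstRow (w.map (shiftLetter k) ++ [k]) ∧
    k + 1 ∉ firstRow (w.map (shiftLetter k) ++ [k]) ∧
    (∀ m, k ≤ m → m + 1 ≤ n →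
      (m + 2 ∈ firstRow (w.map (shiftLetter k) ++ [k]) ↔ m ∈ firstRow w)) ∧
    ((rowInsert k (firstRow (w.map (shiftLetter k)))).2 = none ↔
      ¬ (k ≤ n ∧ n ∈ firstRow w)) := by
  have hS := mem_S_iff.1 hw.1
  have hnd : (w.map (shiftLetter k) ++ [k]).Nodup := by
    refine List.nodup_append.2
      ⟨hS.1.map (shiftLetter_strictMono k).injective, by simp, ?_⟩
    rintro a ha b hb rfl
    rw [List.mem_singleton.1 hb] at ha
    exact notMem_map_shiftLetter ha
  have hup := (increasing_from_iff hw hk1).1 hinc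
  have hle : ∀ m ∈ firstRow w, m ≤ n := fun m hm => ((hS.2 m).1 (mem_of_mem_firstRow hm)).2
  have hcases := firstRow_concat_cases hnd
  rw [firstRow_map (shiftLetter_strictMono k)] at hcases ⊢
  rcases hcases with ⟨hlt, hb, hm⟩ | ⟨z, hz, hkz, hmin, hb, hm⟩
  · have hlt' : ∀ m ∈ firstRow w, m < k := by
      intro m hm'
      by_contra hkm
      have := hlt (m + 1) ((succ_mem_map_shiftLetter (not_lt.1 hkm)).2 hm')
      omega
    refine ⟨fun i hi => ?_, (hm k).2 (Or.inr rfl), ?_, fun m hkm _ => ?_, ?_⟩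
    · rw [hm, mem_map_shiftLetter_of_lt hi]
      exact or_iff_left hi.ne
    · rw [hm]
      rintro (h | h)
      · have := hlt _ h
        omega
      · omega
    · rw [hm]
      constructor
      · rintro (h | h)
        · have := hlt _ h
          omega
        · omega
      · intro h
        have := hlt' _ h
        omega
    · refine iff_of_true hb ?_
      rintro ⟨h1, h2⟩
      have := hlt' _ h2
      omega
  · obtain ⟨y, rfl⟩ : ∃ y, z = y + 1 := ⟨z - 1, by omega⟩
    have hky : k ≤ y := by omega
    rw [succ_mem_map_shiftLetter hky] at hz
    have hmin' : ∀ m ∈ firstRow w, k ≤ m → y ≤ m := by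
      intro m hm' hkm
      have := hmin (m + 1) ((succ_mem_map_shiftLetter hkm).2 hm') (by omega)
      omega
    have hall : ∀ d, y + d ≤ n → y + d ∈ firstRow w := by
      intro d
      induction d with
      | zero => exact fun _ => hz
      | succ d ih => exact fun h => hup (y + d) (by omega) (by omega) (ih (by omega))
    -- Above `k` the first row of `w` is the interval from `y` to `n`. Shifting it and bumping `y +
    -- 1` leaves the interval from `y + 2` to `n + 1`, which explains the shift by two.
    have hall' : ∀ m, k ≤ m → (m ∈ firstRow w ↔ y ≤ m ∧ m ≤ n) := by
      intro m hkm
      constructor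
      · exact fun h => ⟨hmin' m h hkm, hle m h⟩
      · rintro ⟨h1, h2⟩
        have := hall (m - y) (by omega)
        rwa [show y + (m - y) = m by omega] at this
    refine ⟨fun i hi => ?_, (hm k).2 (Or.inr rfl), ?_, fun m hkm hmn => ?_, ?_⟩
    · rw [hm, mem_map_shiftLetter_of_lt hi]
      have h1 : i ≠ y + 1 := by omega
      have h2 : i ≠ k := by omega
      tauto
    · rw [hm, succ_mem_map_shiftLetter le_rfl, hall' k le_rfl]
      omega
    · rw [hm, succ_mem_map_shiftLetter (by omega), hall' _ (by omega), hall' _ hkm]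
      omega
    · refine iff_of_false hb ?_
      have := hle y hz
      simpa using ⟨by omega, (hall' n (by omega)).2 ⟨this, le_rfl⟩⟩

theorem getElem?_map_range' {α : Type*} (f : ℕ → α) (n i : ℕ) :
    ((List.range' 1 n).map f)[i]? = if i < n then some (f (i + 1)) else none := by
  rw [List.getElem?_map]
  split_ifs with h
  · rw [List.getElem?_range' h]
    simp [Nat.add_comm]
  · rw [List.getElem?_eq_none (by simpa using h)]
    rfl

theorem length_Psi (w : List ℕ) : (Psi w).length = w.length + w.length := by
  simp [Psi]

/-- The left half of the path `Ψ`. -/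
def leftHalf (w : List ℕ) : List DyckStep :=
  (List.range' 1 w.length).map fun i => if i ∈ firstRow w then DyckStep.U else DyckStep.D

/-- The right half of the path `Ψ`. -/
def rightHalf (w : List ℕ) : List DyckStep :=
  (List.range' 1 w.length).reverse.map fun i => if i ∈ recRow w then DyckStep.D else DyckStep.U

theorem Psi_eq (w : List ℕ) : Psi w = leftHalf w ++ rightHalf w := rfl

theorem length_leftHalf (w : List ℕ) : (leftHalf w).length = w.length := by simp [leftHalf]

theorem rightHalf_ins (w : List ℕ) (k : ℕ) :
    rightHalf (w.map (shiftLetter k) ++ [k]) =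
      (if (rowInsert k (firstRow (w.map (shiftLetter k)))).2 = none then DyckStep.D
        else DyckStep.U) :: rightHalf w := by
  have hrec := recRow_concat (w.map (shiftLetter k)) k
  rw [recRow_map (shiftLetter_strictMono k), List.length_map] at hrec
  have h1 : w.length + 1 ∉ recRow w := fun h => by
    have := mem_recRow_le h
    omega
  unfold rightHalf
  rw [hrec]
  simp only [List.length_append, List.length_map, List.length_singleton, List.range'_1_concat,
    List.reverse_append, List.reverse_singleton, List.singleton_append, List.map_cons]
  congr 1
  · rw [Nat.add_comm 1]
    split_ifs <;> simp_all
  · refine List.map_congr_left fun i hi => ?_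
    have h2 : i ≠ w.length + 1 := by
      rw [List.mem_reverse, List.mem_range'_1] at hi
      omega
    split_ifs <;> simp_all

/-- The new left half has one step more than the old one, but a peak needs two. The missing step is
the new first step of the right half given by `rightHalf_ins`; it equals the last step of the old
left half, or the down-step of the peak if `k = n + 1`. -/
theorem leftHalf_ins {n k : ℕ} {w : List ℕ} (hw : w ∈ Av n [3, 2, 1]) (hk1 : 1 ≤ k)
    (hkn : k ≤ n + 1) (hinc : ∀ x y, k ≤ y → y < x → ¬ [x, y].Sublist w) :
    leftHalf (w.map (shiftLetter k) ++ [k]) ++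
      [if (rowInsert k (firstRow (w.map (shiftLetter k)))).2 = none then DyckStep.D
        else DyckStep.U] =
      (leftHalf w).take (k - 1) ++ DyckStep.U :: DyckStep.D :: (leftHalf w).drop (k - 1) := by
  have hl := length_of_mem_S hw.1
  obtain ⟨F1, F2, F3, F4, F5⟩ := firstRow_ins hw hk1 hinc
  have hL := length_leftHalf w
  have hL' : (leftHalf (w.map (shiftLetter k) ++ [k])).length = n + 1 := by
    simp [length_leftHalf, hl]
  have hT : ((leftHalf w).take (k - 1)).length = k - 1 := by
    rw [List.length_take, hL]
    omega
  have g1 : ∀ i, i < n + 1 → (leftHalf (w.map (shiftLetter k) ++ [k]))[i]? =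
      some (if i + 1 ∈ firstRow (w.map (shiftLetter k) ++ [k]) then DyckStep.U
        else DyckStep.D) := by
    intro i hi
    unfold leftHalf
    rw [getElem?_map_range', if_pos (by simpa [hl] using hi)]
  have g2 : ∀ i, i < n → (leftHalf w)[i]? =
      some (if i + 1 ∈ firstRow w then DyckStep.U else DyckStep.D) := by
    intro i hi
    unfold leftHalf
    rw [getElem?_map_range', if_pos (by simpa [hl] using hi)]
  apply List.ext_getElem?
  intro i
  rcases lt_or_ge i (k - 1) with hi | hi
  · rw [List.getElem?_append_left (by omega), List.getElem?_append_left (by omega),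
      List.getElem?_take_of_lt hi, g1 i (by omega), g2 i (by omega),
      if_congr (F1 _ (by omega)) rfl rfl]
  rw [List.getElem?_append_right (l₁ := List.take _ _) (by omega), hT]
  rcases hi.eq_or_lt with rfl | hi
  · rw [List.getElem?_append_left (by omega), g1 _ (by omega), if_pos (by
      rwa [Nat.sub_add_cancel hk1])]
    simp
  rcases (show k ≤ i by omega).eq_or_lt with rfl | hi'
  · have h1 : k - (k - 1) = 1 := by omega
    rw [h1]
    -- For `k = n + 1` the down-step of the peak already belongs to the right half.
    rcases hkn.eq_or_lt with rfl | hkn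
    · rw [List.getElem?_append_right (by omega), if_pos (F5.2 (by omega))]
      simp [hL']
    · rw [List.getElem?_append_left (by omega), g1 _ (by omega), if_neg F3]
      simp
  · have h1 : i - (k - 1) = (i - 1 - k) + 2 := by omega
    rw [h1, List.getElem?_cons_succ, List.getElem?_cons_succ, List.getElem?_drop,
      show k - 1 + (i - 1 - k) = i - 2 by omega]
    rcases lt_trichotomy i (n + 1) with hin | rfl | hin
    · rw [List.getElem?_append_left (by omega), g1 _ hin, g2 _ (by omega)]
      have := F4 (i - 1) (by omega) (by omega)
      rw [show i - 1 + 2 = i + 1 by omega] at this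
      rw [show i - 2 + 1 = i - 1 by omega, if_congr this rfl rfl]
    · rw [List.getElem?_append_right (by omega), g2 _ (by omega), hL', Nat.sub_self,
        show n + 1 - 2 + 1 = n by omega, List.getElem?_cons_zero, if_congr F5 rfl rfl]
      have : k ≤ n := by omega
      by_cases h : n ∈ firstRow w <;> simp [h, this]
    · rw [List.getElem?_eq_none (by simp [hL']; omega), List.getElem?_eq_none (by omega)]

/-- Inserting `k` at the end of a 321-avoiding permutation inserts a peak in its path. -/
theorem Psi_ins {n k : ℕ} {w : List ℕ} (hw : w ∈ Av n [3, 2, 1]) (hk1 : 1 ≤ k)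
    (hkn : k ≤ n + 1) (hinc : ∀ x y, k ≤ y → y < x → ¬ [x, y].Sublist w) :
    Psi (ins w (n + 1) k) =
      (Psi w).take (k - 1) ++ DyckStep.U :: DyckStep.D :: (Psi w).drop (k - 1) := by
  have hl := length_of_mem_S hw.1
  have hL := length_leftHalf w
  rw [ins_length_add_one (by omega), Psi_eq, Psi_eq, rightHalf_ins,
    List.take_append_of_le_length (by omega), List.drop_append_of_le_length (by omega),
    List.append_cons, leftHalf_ins hw hk1 hkn hinc]
  simp

theorem getElem?_Psi {n i : ℕ} {w : List ℕ} (hw : w.length = n) (hi : i < n) :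
    (Psi w)[i]? = some (if i + 1 ∈ firstRow w then DyckStep.U else DyckStep.D) := by
  rw [Psi_eq, List.getElem?_append_left (by rw [length_leftHalf]; omega), leftHalf,
    getElem?_map_range', if_pos (by omega)]

theorem count_D_take_Psi {n k : ℕ} {w : List ℕ} (hw : w ∈ Av n [3, 2, 1]) (hkn : k ≤ n + 1) :
    ((Psi w).take (k - 1)).count DyckStep.D = matchedBelow w k := by
  have hl := length_of_mem_S hw.1
  rw [matchedBelow_eq hw hkn, Psi_eq,
    List.take_append_of_le_length (by rw [length_leftHalf]; omega), leftHalf, ← List.map_take,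
    List.take_range'_of_length_ge (by omega), List.count, List.countP_map]
  refine List.countP_congr fun i _ => ?_
  by_cases h : i ∈ firstRow w <;> simp [h]

/-- Both numbers count down-steps among the first `k - 1` steps, which the new peak does not touch.
-/
theorem matchedBelow_ins {n k : ℕ} {w : List ℕ} (hw : w ∈ Av n [3, 2, 1])
    (hw' : ins w (n + 1) k ∈ Av (n + 1) [3, 2, 1]) (hk1 : 1 ≤ k)
    (hkn : k ≤ n + 1) (hinc : ∀ x y, k ≤ y → y < x → ¬ [x, y].Sublist w) :
    matchedBelow (ins w (n + 1) k) k = matchedBelow w k := by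
  have hl := length_Psi w
  rw [length_of_mem_S hw.1] at hl
  rw [← count_D_take_Psi hw hkn, ← count_D_take_Psi hw' (by omega), Psi_ins hw hk1 hkn hinc,
    List.take_append_of_le_length (by simp [hl]; omega), List.take_take, min_self]

/-! ### Dyck words, peaks and tunnels -/

open DyckStep

theorem isDyck_iff {w : List DyckStep} :
    IsDyck w ↔ w.count U = w.count D ∧ ∀ A C, w = A ++ C → A.count D ≤ A.count U := by
  constructor
  · rintro ⟨p, rfl⟩
    refine ⟨p.count_U_eq_count_D, fun A C h => ?_⟩
    have := p.count_D_le_count_U A.length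
    rwa [h, List.take_left'  rfl] at this
  · rintro ⟨h1, h2⟩
    exact ⟨⟨w, h1, fun i => h2 _ _ (List.take_append_drop i w).symm⟩, rfl⟩

theorem isDyck_nil : IsDyck [] := ⟨0, rfl⟩

theorem count_add_count (w : List DyckStep) : w.count U + w.count D = w.length := by
  induction w with
  | nil => rfl
  | cons a w ih => cases a <;> simp <;> omega

theorem isDyck_peak_iff {X Y : List DyckStep} : IsDyck (X ++ U :: D :: Y) ↔ IsDyck (X ++ Y) := by
  rw [isDyck_iff, isDyck_iff]
  constructor
  · rintro ⟨h1, h2⟩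
    refine ⟨by simp at h1 ⊢; omega, fun A C h => ?_⟩
    rcases List.append_eq_append_iff.1 h with ⟨T, rfl, rfl⟩ | ⟨T, rfl, rfl⟩
    · have := h2 (X ++ U :: D :: T) C (by simp)
      simp at this ⊢
      omega
    · exact h2 A (T ++ U :: D :: Y) (by simp)
  · rintro ⟨h1, h2⟩
    refine ⟨by simp at h1 ⊢; omega, fun A C h => ?_⟩
    rcases List.append_eq_append_iff.1 h with ⟨T, rfl, hT⟩ | ⟨T, rfl, rfl⟩
    · have h3 := h2 X Y rfl
      rcases T with _ | ⟨a, _ | ⟨b, T⟩⟩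
      · simpa using h3
      · simp only [List.cons_append, List.nil_append, List.cons.injEq] at hT
        obtain ⟨rfl, -⟩ := hT
        simp
        omega
      · simp only [List.cons_append, List.cons.injEq] at hT
        obtain ⟨rfl, rfl, rfl⟩ := hT
        have := h2 (X ++ T) C (by simp)
        simp at this ⊢
        omega
    · exact h2 A (T ++ Y) (by simp)

theorem isTunnel_peak (X Y : List DyckStep) (h : IsDyck (X ++ Y)) :
    IsTunnel (X ++ U :: D :: Y) (X.count U + 1) (X.count D + 1) :=
  ⟨X, [], Y, by simp, isDyck_nil, h, rfl, by simp⟩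

/-- Whether the peak lands before, inside or after the tunnel, `B` and `A ++ C` remain Dyck words;
only the numbers of the steps to the right of the peak go up by one. -/
theorem IsTunnel.insert_peak {X Y : List DyckStep} {i j : ℕ} (h : IsTunnel (X ++ Y) i j) :
    IsTunnel (X ++ U :: D :: Y) (if i ≤ X.count U then i else i + 1)
      (shiftLetter (X.count D + 1) j) := by
  obtain ⟨A, B, C, hw, hB, hAC, rfl, rfl⟩ := h
  unfold shiftLetter
  rcases List.append_eq_append_iff.1 hw with ⟨T, rfl, rfl⟩ | ⟨T, rfl, hT⟩
  · refine ⟨X ++ U :: D :: T, B, C, by simp, hB, ?_, ?_, ?_⟩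
    · have : IsDyck (X ++ (T ++ C)) := by simpa using hAC
      simpa using isDyck_peak_iff.2 this
    · rw [if_neg (by simp)]
      simp
      omega
    · rw [if_pos (by simp)]
      simp
      omega
  · rcases T with _ | ⟨a, T⟩
    · refine ⟨A ++ [U, D], B, C, by simpa using hT.symm, hB, ?_, ?_, ?_⟩
      · simpa using isDyck_peak_iff.2 hAC
      · simp
      · simp
        omega
    simp only [List.cons_append, List.cons.injEq] at hT
    obtain ⟨rfl, hT⟩ := hT
    rcases List.append_eq_append_iff.1 hT with ⟨T', rfl, hT'⟩ | ⟨T', rfl, rfl⟩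
    · rcases T' with _ | ⟨b, T'⟩
      · refine ⟨A, B ++ [U, D], C, by simpa using hT'.symm, ?_, hAC, ?_, ?_⟩
        · exact isDyck_peak_iff.2 (by simpa using hB)
        · simp
        · simp
          omega
      simp only [List.cons_append, List.cons.injEq] at hT'
      obtain ⟨rfl, rfl⟩ := hT'
      refine ⟨A, B, T' ++ U :: D :: Y, by simp, hB, ?_, ?_, ?_⟩
      · have : IsDyck ((A ++ T') ++ Y) := by simpa using hAC
        simpa using isDyck_peak_iff.2 this
      · simp
      · rw [if_neg (by simp)]
    · refine ⟨A, T ++ U :: D :: T', C, by simp, isDyck_peak_iff.2 hB, hAC, ?_, ?_⟩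
      · simp
      · rw [if_pos (by simp)]
        simp
        omega

/-- Two prefixes of a word that are followed by an up-step and have the same number of up-steps
coincide; otherwise the one with fewer up-steps is shorter. -/
theorem prefix_of_count_lt {A A' R R' : List DyckStep} (h : A ++ U :: R = A' ++ U :: R')
    (hc : A.count U < A'.count U) : ∃ T, A' = A ++ U :: T ∧ R = T ++ U :: R' := by
  rcases List.append_eq_append_iff.1 h with ⟨T, rfl, hT⟩ | ⟨T, rfl, hT⟩
  · rcases T with _ | ⟨a, T⟩
    · simp at hc
    · simp only [List.cons_append, List.cons.injEq] at hT
      obtain ⟨rfl, rfl⟩ := hT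
      exact ⟨T, rfl, rfl⟩
  · simp at hc

theorem prefix_eq_of_count_eq {A A' R R' : List DyckStep} (h : A ++ U :: R = A' ++ U :: R')
    (hc : A.count U = A'.count U) : A = A' ∧ R = R' := by
  rcases List.append_eq_append_iff.1 h with ⟨T, rfl, hT⟩ | ⟨T, rfl, hT⟩ <;>
  · rcases T with _ | ⟨a, T⟩
    · simpa [eq_comm] using hT
    · simp only [List.cons_append, List.cons.injEq] at hT
      obtain ⟨rfl, rfl⟩ := hT
      simp at hc

/-- A Dyck word has no prefix `B D` with `B` a Dyck word. -/
theorem IsDyck.not_prefix {B B' T : List DyckStep} (hB' : IsDyck B')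
    (hB : B.count U ≤ B.count D) : B' ≠ B ++ D :: T := by
  intro h
  have := (isDyck_iff.1 hB').2 (B ++ [D]) T (by simp [h])
  simp at this
  omega

/-- The number of the up-step fixes `A`. If the two inner Dyck words differed, one would have the
other followed by `D` as a prefix. -/
theorem IsTunnel.unique {w : List DyckStep} {i j j' : ℕ} (h : IsTunnel w i j)
    (h' : IsTunnel w i j') : j = j' := by
  obtain ⟨A, B, C, rfl, hB, -, rfl, rfl⟩ := h
  obtain ⟨A', B', C', hw, hB', -, hi, rfl⟩ := h'
  obtain ⟨rfl, hR⟩ := prefix_eq_of_count_eq hw (by omega)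
  rcases List.append_eq_append_iff.1 hR with ⟨T, rfl, hT⟩ | ⟨T, rfl, hT⟩ <;>
  · rcases T with _ | ⟨a, T⟩
    · simp
    · simp only [List.cons_append, List.cons.injEq] at hT
      obtain ⟨rfl, rfl⟩ := hT
      first
      | exact absurd rfl (hB'.not_prefix (T := T) (isDyck_iff.1 hB).1.le)
      | exact absurd rfl (hB.not_prefix (T := T) (isDyck_iff.1 hB').1.le)

/-- If the up-step of one tunnel is before that of another one, and likewise for the down-steps,
then the first tunnel ends before the second one starts. -/
theorem count_D_of_lt {A B C A' B' C' : List DyckStep}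
    (h : A ++ U :: (B ++ D :: C) = A' ++ U :: (B' ++ D :: C')) (hB : IsDyck B) (hB' : IsDyck B')
    (h1 : A.count U < A'.count U) (h2 : (A ++ B).count D < (A' ++ B').count D) :
    (A ++ B).count D + 1 ≤ A'.count D := by
  obtain ⟨T, rfl, hT⟩ := prefix_of_count_lt h h1
  rcases List.append_eq_append_iff.1 hT with ⟨T', rfl, hT'⟩ | ⟨T', rfl, hT'⟩
  · rcases T' with _ | ⟨a, T'⟩
    · simp at hT'
    · simp only [List.cons_append, List.cons.injEq] at hT'
      obtain ⟨rfl, -⟩ := hT'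
      simp
  · rcases T' with _ | ⟨a, T'⟩
    · simp at hT'
    · simp only [List.cons_append, List.cons.injEq] at hT'
      obtain ⟨rfl, hT'⟩ := hT'
      -- The second up-step lies inside the first tunnel, `B = T U T'`. As `B` is balanced and its
      -- prefix `T` does not go below the axis, `T'` has more down-steps than up-steps, so it cannot
      -- be a prefix of `B'`: crossing is impossible.
      have h3 := (isDyck_iff.1 hB).1
      have h4 := (isDyck_iff.1 hB).2 T _ rfl
      simp at h3
      rcases List.append_eq_append_iff.1 hT' with ⟨V, rfl, hV⟩ | ⟨V, rfl, hV⟩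
      · simp at h2
      · rcases V with _ | ⟨a, V⟩
        · simp at h2
        · simp only [List.cons_append, List.cons.injEq] at hV
          obtain ⟨rfl, rfl⟩ := hV
          exact absurd rfl (hB'.not_prefix (B := T') (T := V) (by omega))

/-- Every non-empty Dyck word of semi-length `n` has a peak whose up-step is among the first `n`
steps.  After the last one of these, an up-step among the first `n` steps is followed by another
up-step. -/
theorem exists_last_peak {n : ℕ} {w : List DyckStep} (hw : IsDyck w) (hn : w.count U = n + 1) :
    ∃ X Y, w = X ++ U :: D :: Y ∧ X.length ≤ n ∧
      ∀ p, X.length < p → p ≤ n → w[p]? = some U → w[p + 1]? = some U := by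
  have hw' := isDyck_iff.1 hw
  have hlen : w.length = 2 * n + 2 := by
    rw [← count_add_count]
    omega
  let P : ℕ → Prop := fun p => w[p]? = some U ∧ w[p + 1]? = some D
  have dich : ∀ p, p < w.length → w[p]? = some U ∨ w[p]? = some D := by
    intro p hp
    rw [List.getElem?_eq_getElem hp]
    rcases w[p].dichotomy with h | h <;> simp [h]
  have hex : ∃ p ≤ n, P p := by
    by_contra hno
    push Not at hno
    -- Without such a peak the word would begin with `n + 2` up-steps.
    have h0 : ∀ p, p ≤ n + 1 → w[p]? = some U := by
      intro p
      induction p with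
      | zero =>
        intro _
        refine (dich 0 (by omega)).resolve_right fun h => ?_
        rcases w with _ | ⟨a, w⟩
        · simp at h
        · simp at h
          subst h
          have := hw'.2 [D] w rfl
          simp at this
      | succ p ih =>
        intro hp
        exact (dich (p + 1) (by omega)).resolve_right fun h => hno p (by omega) ⟨ih (by omega), h⟩
    have h1 : w.take (n + 2) = List.replicate (n + 2) U := by
      rw [List.eq_replicate_iff]
      refine ⟨by simp; omega, fun b hb => ?_⟩
      obtain ⟨p, hp, rfl⟩ := List.mem_take_iff_getElem.1 hb
      have := h0 p (by omega)
      rw [List.getElem?_eq_getElem (by omega)] at this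
      simpa using this
    have h2 : (w.take (n + 2)).count U ≤ w.count U := (List.take_sublist _ _).count_le _
    rw [h1, List.count_replicate_self] at h2
    omega
  classical
  obtain ⟨p₀, hp₀, hP₀⟩ := hex
  set k := Nat.findGreatest P n with hk
  have hPk : P k := Nat.findGreatest_spec hp₀ hP₀
  have hkn : k ≤ n := Nat.findGreatest_le n
  obtain ⟨hU, hD⟩ := hPk
  have hXl : (w.take k).length = k := by simp; omega
  refine ⟨w.take k, w.drop (k + 2), ?_, by omega, ?_⟩
  · conv_lhs => rw [← List.take_append_drop k w]
    rw [List.drop_eq_getElem_cons (by omega), List.drop_eq_getElem_cons (by omega)]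
    rw [List.getElem?_eq_getElem (by omega)] at hU hD
    simp only [Option.some.injEq] at hU hD
    rw [hU, hD]
  · intro p hp hpn hpU
    rw [hXl] at hp
    refine (dich (p + 1) (by omega)).resolve_right fun h => ?_
    exact Nat.findGreatest_is_greatest hp hpn ⟨hpU, h⟩

/-- Induction by removing a peak: its up-step has an evident tunnel, and the tunnels of the other
up-steps survive the insertion. -/
theorem exists_isTunnel {n : ℕ} : ∀ {w : List DyckStep}, IsDyck w → w.count U = n →
    ∀ i, 1 ≤ i → i ≤ n → ∃ j, IsTunnel w i j := by
  induction n with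
  | zero => intros; omega
  | succ n ih =>
    intro w hw hn i h1 h2
    obtain ⟨X, Y, rfl, -, -⟩ := exists_last_peak hw hn
    have hXY := isDyck_peak_iff.1 hw
    have hn' : (X ++ Y).count U = n := by simp at hn ⊢; omega
    have hX : X.count U ≤ n := by simp at hn'; omega
    rcases lt_trichotomy i (X.count U + 1) with hi | rfl | hi
    · obtain ⟨j, hj⟩ := ih hXY hn' i h1 (by omega)
      have := hj.insert_peak
      rw [if_pos (by omega)] at this
      exact ⟨_, this⟩
    · exact ⟨_, isTunnel_peak X Y hXY⟩
    · obtain ⟨j, hj⟩ := ih hXY hn' (i - 1) (by omega) (by omega)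
      have := hj.insert_peak
      rw [if_neg (by omega), Nat.sub_add_cancel h1] at this
      exact ⟨_, this⟩

/-! ### The 132-avoiding permutation of a Dyck path -/

theorem length_PhiInv (w : List DyckStep) : (PhiInv w).length = w.count U := by simp [PhiInv]

theorem getElem?_PhiInv {w : List DyckStep} {i j : ℕ} (h : IsTunnel w (w.count U - i) j)
    (hi : i < w.count U) : (PhiInv w)[i]? = some j := by
  unfold PhiInv
  rw [getElem?_map_range', if_pos hi, Nat.add_sub_add_right]
  have : {j | IsTunnel w (w.count U - i) j} = {j} :=
    Set.eq_singleton_iff_unique_mem.2 ⟨h, fun _ h' => IsTunnel.unique h' h⟩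
  rw [this, csInf_singleton]

theorem isTunnel_of_getElem? {w : List DyckStep} (hw : IsDyck w) {i j : ℕ}
    (h : (PhiInv w)[i]? = some j) : i < w.count U ∧ IsTunnel w (w.count U - i) j := by
  have hi : i < w.count U := by
    by_contra hi
    rw [List.getElem?_eq_none (by rw [length_PhiInv]; omega)] at h
    simp at h
  obtain ⟨j', hj'⟩ := exists_isTunnel hw rfl (w.count U - i) (by omega) (by omega)
  rw [getElem?_PhiInv hj' hi] at h
  simp only [Option.some.injEq] at h
  exact ⟨hi, h ▸ hj'⟩

/-- Inserting a peak in a Dyck path inserts a letter in the permutation. -/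
theorem PhiInv_peak {X Y : List DyckStep} (h : IsDyck (X ++ Y)) :
    PhiInv (X ++ U :: D :: Y) = ins (PhiInv (X ++ Y)) (Y.count U + 1) (X.count D + 1) := by
  have hc : (X ++ U :: D :: Y).count U = (X ++ Y).count U + 1 := by simp; omega
  have hc' : (X ++ Y).count U = X.count U + Y.count U := by simp
  apply List.ext_getElem?
  intro i
  rw [getElem?_ins (by rw [length_PhiInv]; omega)]
  rcases lt_or_ge i (X.count U + Y.count U + 1) with hi | hi
  -- Letters are indexed by up-steps from the right, so the indices `i < Y.count U` belong to
  -- up-steps after the peak; counted from the left, these move by one.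
  · split_ifs with h1 h2
    · obtain ⟨j, hj⟩ := exists_isTunnel h rfl ((X ++ Y).count U - i) (by omega) (by omega)
      rw [getElem?_PhiInv hj (by omega), Option.map_some]
      have := hj.insert_peak
      rw [if_neg (by omega)] at this
      apply getElem?_PhiInv _ (by omega)
      rwa [hc, show (X ++ Y).count U + 1 - i = (X ++ Y).count U - i + 1 by omega]
    · apply getElem?_PhiInv _ (by omega)
      rw [hc, show (X ++ Y).count U + 1 - i = X.count U + 1 by omega]
      exact isTunnel_peak X Y h
    · obtain ⟨j, hj⟩ := exists_isTunnel h rfl ((X ++ Y).count U - (i - 1)) (by omega) (by omega)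
      rw [getElem?_PhiInv hj (by omega), Option.map_some]
      have := hj.insert_peak
      rw [if_pos (by omega)] at this
      apply getElem?_PhiInv _ (by omega)
      rwa [hc, show (X ++ Y).count U + 1 - i = (X ++ Y).count U - (i - 1) by omega]
  · rw [if_neg (by omega), if_neg (by omega), List.getElem?_eq_none, List.getElem?_eq_none]
    · rfl
    · rw [length_PhiInv]
      omega
    · rw [length_PhiInv]
      omega

theorem PhiInv_mem_S {n : ℕ} : ∀ {w : List DyckStep}, IsDyck w → w.count U = n →
    PhiInv w ∈ S n := by
  induction n with
  | zero =>
    intro w _ hn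
    have : PhiInv w = [] := List.length_eq_zero_iff.1 (by rw [length_PhiInv, hn])
    rw [this, mem_S_iff]
    simp
    omega
  | succ n ih =>
    intro w hw hn
    obtain ⟨X, Y, rfl, -, -⟩ := exists_last_peak hw hn
    have hXY := isDyck_peak_iff.1 hw
    have hn' : (X ++ Y).count U = n := by simp at hn ⊢; omega
    rw [PhiInv_peak hXY]
    refine ins_mem_S (ih hXY hn') (by omega) ?_
    have := (isDyck_iff.1 hXY).2 X Y rfl
    simp at hn'
    omega

/-- For letters `x, y, z` in this order, the up-steps occur in the order of `z`, `y`, `x`. If `z <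
y`, the tunnel of `z` ends before that of `y` starts, hence before the up-step of `x`, so `z < x`.
-/
theorem PhiInv_mem_Av {n : ℕ} {w : List DyckStep} (hw : IsDyck w) (hn : w.count U = n) :
    PhiInv w ∈ Av n [1, 3, 2] := by
  refine ⟨PhiInv_mem_S hw hn, ?_⟩
  rw [contains_132_iff]
  rintro ⟨x, y, z, hs, hxz, hzy⟩
  obtain ⟨i, j, k, hij, hjk, hi, hj, hk⟩ := triple_sublist_iff.1 hs
  obtain ⟨hi, A₁, B₁, C₁, h₁, hB₁, -, hu₁, rfl⟩ := isTunnel_of_getElem? hw hi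
  obtain ⟨hj, A₂, B₂, C₂, h₂, hB₂, -, hu₂, rfl⟩ := isTunnel_of_getElem? hw hj
  obtain ⟨hk, A₃, B₃, C₃, h₃, hB₃, -, hu₃, rfl⟩ := isTunnel_of_getElem? hw hk
  have h4 := count_D_of_lt (h₃.symm.trans h₂) hB₃ hB₂ (by omega) (by omega)
  obtain ⟨T, hT, -⟩ := prefix_of_count_lt (h₂.symm.trans h₁) (by omega)
  have h5 : A₂.count D ≤ A₁.count D := by simp [hT]
  simp at h4 hxz
  omega

theorem exists_first_run {w : List DyckStep} (h : D ∈ w) :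
    ∃ r Y, w = List.replicate r U ++ D :: Y := by
  induction w with
  | nil => simp at h
  | cons a w ih =>
    rcases a.dichotomy with rfl | rfl
    · obtain ⟨r, Y, rfl⟩ := ih (by simpa using h)
      exact ⟨r + 1, Y, rfl⟩
    · exact ⟨0, w, rfl⟩

/-- Every 132-avoiding permutation comes from a Dyck path. -/
theorem exists_PhiInv_eq {n : ℕ} : ∀ {α : List ℕ}, α ∈ Av n [1, 3, 2] →
    ∃ w, IsDyck w ∧ w.count U = n ∧ PhiInv w = α := by
  induction n with
  | zero =>
    intro α hα
    have h0 : α = [] := List.length_eq_zero_iff.1 (length_of_mem_S hα.1)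
    exact ⟨[], isDyck_nil, rfl, by simp [h0, PhiInv]⟩
  | succ n ih =>
    intro α hα
    have h1 : 1 ∈ α := ((mem_S_iff.1 hα.1).2 1).2 (by omega)
    obtain ⟨s, t, rfl⟩ := List.append_of_mem h1
    have hnd := (mem_S_iff.1 hα.1).1
    have h1st : 1 ∉ s ++ t := (List.nodup_cons.1 (List.perm_middle.nodup_iff.1 hnd)).1
    have hβS := unshift_mem_S hα.1
    have hst := map_shiftLetter_map_unshiftLetter h1st
    have hβ : (s ++ t).map (unshiftLetter 1) ∈ Av n [1, 3, 2] := by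
      refine ⟨hβS, not_contains_132_of_map (shiftLetter_strictMono 1) ?_ hα.2⟩
      rw [hst]
      exact (List.Sublist.refl s).append (List.sublist_cons_self 1 t)
    have hins : ins ((s ++ t).map (unshiftLetter 1)) (s.length + 1) 1 = s ++ 1 :: t := by
      have := ins_append (s.map (unshiftLetter 1)) (t.map (unshiftLetter 1)) 1
      rw [← List.map_append, List.length_map] at this
      rw [this, map_shiftLetter_map_unshiftLetter (fun h => h1st (by simp [h])),
        map_shiftLetter_map_unshiftLetter (fun h => h1st (by simp [h]))]
    obtain ⟨w, hw, hn, hwβ⟩ := ih hβ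
    have hsn : s.length + t.length = n := by
      have := length_of_mem_S hβS
      simpa using this
    rcases Nat.eq_zero_or_pos n with rfl | hpos
    · have hw0 : w = [] := by
        apply List.length_eq_zero_iff.1
        rw [← count_add_count, ← (isDyck_iff.1 hw).1, hn]
      subst hw0
      refine ⟨[U, D], isDyck_peak_iff (X := []).2 isDyck_nil, by simp, ?_⟩
      have := PhiInv_peak (X := []) (Y := []) isDyck_nil
      simp only [List.nil_append, List.count_nil] at this
      rw [this, ← hins, ← hwβ, show s.length = 0 by omega]
    · have hD : D ∈ w := by
        rw [← List.count_pos_iff, ← (isDyck_iff.1 hw).1]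
        omega
      obtain ⟨r, Y, rfl⟩ := exists_first_run hD
      have hr : r ≠ 0 := by
        rintro rfl
        have := (isDyck_iff.1 hw).2 [D] Y rfl
        simp at this
      obtain ⟨r, rfl⟩ := Nat.exists_eq_add_of_le' (Nat.pos_of_ne_zero hr)
      have hsplit : List.replicate (r + 1) U ++ D :: Y = List.replicate r U ++ U :: D :: Y := by
        rw [List.replicate_succ']
        simp
      have hYn : r + Y.count U + 1 = n := by
        rw [hsplit] at hn
        simp at hn
        omega
      have hw2 : IsDyck (List.replicate r U ++ Y) := by
        rw [hsplit] at hw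
        exact isDyck_peak_iff.1 hw
      have hone : ((s ++ t).map (unshiftLetter 1))[Y.count U]? = some 1 := by
        rw [← hwβ, hsplit, PhiInv_peak hw2, getElem?_ins (by rw [length_PhiInv]; simp)]
        simp [List.count_replicate]
      -- In `β` the letter 1 comes from the first peak of `w`; it is the letter 2 of `α`. If the 1
      -- of `α` were further left and not adjacent, any letter between them would give a 132.
      have hYs : Y.count U ≤ s.length := by
        by_contra hlt
        have h2 : (s ++ 1 :: t)[Y.count U + 1]? = some 2 := by
          rw [← hins, getElem?_ins (by simp), if_neg (by omega), if_neg (by omega),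
            Nat.add_sub_cancel, hone]
          rfl
        have hlen : (s ++ 1 :: t).length = n + 1 := length_of_mem_S hα.1
        obtain ⟨y, hy⟩ : ∃ y, (s ++ 1 :: t)[s.length + 1]? = some y :=
          ⟨_, List.getElem?_eq_getElem (by omega)⟩
        have hs1 : (s ++ 1 :: t)[s.length]? = some 1 := by simp
        have hy1 : y ≠ 1 := by
          rintro rfl
          have := (List.getElem?_inj (by omega) hnd).1 (hy.trans hs1.symm)
          omega
        have hy2 : y ≠ 2 := by
          rintro rfl
          have := (List.getElem?_inj (by omega) hnd).1 (hy.trans h2.symm)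
          omega
        have hy0 := ((mem_S_iff.1 hα.1).2 y).1 (List.mem_of_getElem? hy)
        exact hα.2 (contains_132_iff.2 ⟨1, y, 2, triple_sublist_iff.2
          ⟨s.length, s.length + 1, Y.count U + 1, by omega, by omega, hs1, hy, h2⟩,
          by omega, by omega⟩)
      -- The new peak goes into the initial run of up-steps, where it creates the letter 1. Leaving
      -- `s.length` up-steps to its right puts that letter in the right place; `hYs` ensures that
      -- the run is long enough, with adjacency allowed.
      set a := n - s.length with ha
      set b := r + 1 - a with hb
      have hab : r + 1 = a + b := by omega
      rw [hab, List.replicate_add, List.append_assoc] at hw hwβ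
      refine ⟨List.replicate a U ++ U :: D :: (List.replicate b U ++ D :: Y),
        isDyck_peak_iff.2 hw, ?_, ?_⟩
      · simp
        omega
      · rw [PhiInv_peak hw, hwβ, ← hins]
        congr 1
        · simp
          omega
        · simp [List.count_replicate]

/-! ### Deleting the last letter, and `Psi` onto Dyck paths -/

theorem exists_eq_ins {n : ℕ} {σ : List ℕ} (hσ : σ ∈ Av (n + 1) [3, 2, 1]) :
    red (σ.take n) ∈ Av n [3, 2, 1] ∧ 1 ≤ letter σ (n + 1) ∧ letter σ (n + 1) ≤ n + 1 ∧
    σ = ins (red (σ.take n)) (n + 1) (letter σ (n + 1)) ∧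
    ∀ x y, letter σ (n + 1) ≤ y → y < x → ¬ [x, y].Sublist (red (σ.take n)) := by
  have hl := length_of_mem_S hσ.1
  obtain ⟨s, k, rfl⟩ : ∃ s k, σ = s ++ [k] := by
    refine ⟨σ.dropLast, σ.getLast ?_, (List.dropLast_append_getLast _).symm⟩
    rintro rfl
    simp at hl
  have hs : s.length = n := by simpa using hl
  have hk : letter (s ++ [k]) (n + 1) = k := hs ▸ letter_append_cons s [] k
  have hred := red_of_concat_mem_S hσ.1
  have hks : k ∉ s := fun h =>
    (List.nodup_append.1 (mem_S_iff.1 hσ.1).1).2.2 k h k (by simp) rfl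
  have hmap := map_shiftLetter_map_unshiftLetter hks
  have hkm := ((mem_S_iff.1 hσ.1).2 k).1 (by simp)
  rw [hk, List.take_left' hs, hred]
  have hS : s.map (unshiftLetter k) ∈ S n := by simpa using unshift_mem_S hσ.1
  refine ⟨⟨hS, ?_⟩, hkm.1, hkm.2, ?_, ?_⟩
  · exact not_contains_321_of_map (shiftLetter_strictMono k)
      (hmap.symm ▸ List.sublist_append_left s [k] :
        ((s.map (unshiftLetter k)).map (shiftLetter k)).Sublist (s ++ [k])) hσ.2
  · rw [ins_length_add_one (by simpa using hs), hmap]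
  · exact increasing_of_ins (hmap.symm ▸ hσ.2)

theorem ins_mem_Av {n k : ℕ} {w : List ℕ} (hw : w ∈ Av n [3, 2, 1]) (hk1 : 1 ≤ k)
    (hkn : k ≤ n + 1) (hinc : ∀ x y, k ≤ y → y < x → ¬ [x, y].Sublist w) :
    ins w (n + 1) k ∈ Av (n + 1) [3, 2, 1] := by
  refine ⟨ins_mem_S hw.1 hk1 hkn, ?_⟩
  have hlt := fun a b => (shiftLetter_strictMono k).lt_iff_lt (a := a) (b := b)
  rw [ins_length_add_one (by rw [length_of_mem_S hw.1]), contains_321_iff]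
  rintro ⟨x, y, z, hs, hzy, hyx⟩
  obtain ⟨l₁, l₂, h1, h2, h3⟩ := List.sublist_append_iff.1 hs
  obtain ⟨l, hl, rfl⟩ := List.sublist_map_iff.1 h2
  rcases List.sublist_singleton.1 h3 with rfl | rfl
  · obtain ⟨a, b, c, rfl⟩ := List.length_eq_three.1
      (show l.length = 3 by simpa using (congrArg List.length h1).symm)
    simp only [List.map_cons, List.map_nil, List.append_nil, List.cons.injEq, and_true] at h1
    obtain ⟨rfl, rfl, rfl⟩ := h1
    rw [hlt] at hzy hyx
    exact hw.2 (contains_321_iff.2 ⟨a, b, c, hl, hzy, hyx⟩)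
  · obtain ⟨a, b, rfl⟩ := List.length_eq_two.1
      (show l.length = 2 by simpa using (congrArg List.length h1).symm)
    simp only [List.map_cons, List.map_nil, List.cons_append, List.nil_append, List.cons.injEq,
      and_true] at h1
    obtain ⟨rfl, rfl, rfl⟩ := h1
    rw [hlt] at hyx
    refine hinc a b ?_ hyx hl
    by_contra hb
    simp [shiftLetter, hb] at hzy
    omega

theorem Psi_isDyck {n : ℕ} : ∀ {w : List ℕ}, w ∈ Av n [3, 2, 1] →
    IsDyck (Psi w) ∧ (Psi w).count U = n := by
  induction n with
  | zero =>
    intro w hw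
    have h0 : w = [] := List.length_eq_zero_iff.1 (length_of_mem_S hw.1)
    subst h0
    exact ⟨isDyck_nil, rfl⟩
  | succ n ih =>
    intro w hw
    obtain ⟨h1, h2, h3, h4, h5⟩ := exists_eq_ins hw
    obtain ⟨h6, h7⟩ := ih h1
    rw [h4, Psi_ins h1 h2 h3 h5]
    rw [← List.take_append_drop (letter w (n + 1) - 1) (Psi (red (w.take n)))] at h6 h7
    refine ⟨isDyck_peak_iff.2 h6, ?_⟩
    simp only [List.count_append] at h7
    simp
    omega

theorem getElem?_peak {X Y : List DyckStep} {p : ℕ} (hp : X.length ≤ p) :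
    (X ++ U :: D :: Y)[p + 2]? = (X ++ Y)[p]? := by
  rw [List.getElem?_append_right (by omega), List.getElem?_append_right hp,
    show p + 2 - X.length = p - X.length + 2 by omega]
  rfl

theorem getElem?_Psi_eq_U {n i : ℕ} {w : List ℕ} (hw : w.length = n) (hi : i < n) :
    (Psi w)[i]? = some U ↔ i + 1 ∈ firstRow w := by
  rw [getElem?_Psi hw hi]
  simp

/-- Remove the last peak of the left half. That no peak follows it there is, by
`increasing_from_iff`, the condition under which `Psi_ins` puts it back. -/
theorem exists_Psi_eq {n : ℕ} : ∀ {w : List DyckStep}, IsDyck w → w.count U = n →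
    ∃ σ ∈ Av n [3, 2, 1], Psi σ = w := by
  induction n with
  | zero =>
    intro w hw hn
    have hw0 : w = [] := by
      apply List.length_eq_zero_iff.1
      rw [← count_add_count, ← (isDyck_iff.1 hw).1, hn]
    refine ⟨[], ⟨mem_S_iff.2 ⟨List.nodup_nil, fun x => by simp; omega⟩, ?_⟩, hw0.symm⟩
    rw [contains_321_iff]
    rintro ⟨x, y, z, h, -⟩
    simp at h
  | succ n ih =>
    intro w hw hn
    obtain ⟨X, Y, rfl, hX, hlast⟩ := exists_last_peak hw hn
    obtain ⟨π, hπ, hXY⟩ := ih (isDyck_peak_iff.1 hw) (by simp at hn ⊢; omega)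
    have hl := length_of_mem_S hπ.1
    have hinc : ∀ x y, X.length + 1 ≤ y → y < x → ¬ [x, y].Sublist π := by
      rw [increasing_from_iff hπ (by omega)]
      intro i hi hin hmem
      obtain ⟨i, rfl⟩ := Nat.exists_eq_add_of_le' (show 1 ≤ i by omega)
      rw [← getElem?_Psi_eq_U hl (by omega), hXY] at hmem ⊢
      rw [← getElem?_peak (by omega)] at hmem ⊢
      exact hlast _ (by omega) (by omega) hmem
    refine ⟨ins π (n + 1) (X.length + 1), ins_mem_Av hπ (by omega) (by omega) hinc, ?_⟩
    rw [Psi_ins hπ (by omega) (by omega) hinc, hXY]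
    simp

/-! ### The smallest non-excedance -/

theorem mem_nonExcedances_iff {w : List ℕ} {i : ℕ} :
    i + 1 ∈ nonExcedances w ↔ ∃ j, w[i]? = some j ∧ j ≤ i + 1 := by
  unfold nonExcedances
  simp only [List.mem_filter, List.mem_range'_1, decide_eq_true_eq]
  constructor
  · rintro ⟨h1, h2⟩
    have h3 : w[i]? = some w[i] := List.getElem?_eq_getElem (by omega)
    exact ⟨_, h3, letter_eq h3 ▸ h2⟩
  · rintro ⟨j, h1, h2⟩
    obtain ⟨h3, -⟩ := List.getElem?_eq_some_iff.1 h1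
    exact ⟨by omega, (letter_eq h1).symm ▸ h2⟩

theorem pos_of_mem_nonExcedances {w : List ℕ} {i : ℕ} (h : i ∈ nonExcedances w) : 1 ≤ i := by
  have := List.mem_of_mem_filter h
  rw [List.mem_range'_1] at this
  exact this.1

/-- The last peak in the left half of a Dyck path corresponds to the smallest non-excedance. -/
theorem isLeast_nonExcedances {n : ℕ} {X Y : List DyckStep} (hw : IsDyck (X ++ U :: D :: Y))
    (hn : (X ++ U :: D :: Y).count U = n + 1) (hX : X.length ≤ n)
    (hlast : ∀ p, X.length < p → p ≤ n → (X ++ U :: D :: Y)[p]? = some U →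
      (X ++ U :: D :: Y)[p + 1]? = some U) :
    IsLeast {i | i ∈ nonExcedances (PhiInv (X ++ U :: D :: Y))} (Y.count U + 1) := by
  have hc : X.count U + Y.count U = n := by simp at hn; omega
  have hXl := count_add_count X
  constructor
  · refine mem_nonExcedances_iff.2 ⟨X.count D + 1, getElem?_PhiInv ?_ (by omega), by omega⟩
    rw [hn, show n + 1 - Y.count U = X.count U + 1 by omega]
    exact isTunnel_peak X Y (isDyck_peak_iff.1 hw)
  · intro i hi
    obtain ⟨i, rfl⟩ := Nat.exists_eq_add_of_le' (pos_of_mem_nonExcedances hi)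
    obtain ⟨j, hj, hji⟩ := mem_nonExcedances_iff.1 hi
    obtain ⟨hi', A, B, C, h1, hB, -, hu, rfl⟩ := isTunnel_of_getElem? hw hj
    -- A smaller non-excedance would have its up-step right of the peak. Its defining inequality
    -- says that `A.length + B.count D ≤ n`, so `hlast` forces `B.count D + 2` consecutive up-steps
    -- after `A`. They would lie within `U B D`, which has only `B.count D + 1` up-steps.
    by_contra hlt
    obtain ⟨T, rfl, -⟩ := prefix_of_count_lt h1 (by omega)
    have hB' := (isDyck_iff.1 hB).1
    have hBl := count_add_count B
    have hAl := count_add_count (X ++ U :: T)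
    rw [h1] at hlast
    set A := X ++ U :: T with hA
    have hXA : X.length < A.length := by simp [hA]
    have hbound : A.length + B.count D ≤ n := by
      rw [List.count_append] at hji
      omega
    have hup : ∀ t, t ≤ B.count D + 1 → (U :: (B ++ D :: C))[t]? = some U := by
      intro t
      induction t with
      | zero => simp
      | succ t ih =>
        intro ht
        have := hlast (A.length + t) (by omega) (by omega)
        rw [List.getElem?_append_right (by omega), List.getElem?_append_right (by omega),
          show A.length + t - A.length = t by omega,
          show A.length + t + 1 - A.length = t + 1 by omega] at this
        exact this (ih (by omega))
    have h3 : (U :: (B ++ D :: C)).take (B.count D + 2) = List.replicate (B.count D + 2) U := by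
      rw [List.eq_replicate_iff]
      refine ⟨by simp; omega, fun b hb => ?_⟩
      obtain ⟨p, hp, rfl⟩ := List.mem_take_iff_getElem.1 hb
      have := hup p (by omega)
      rw [List.getElem?_eq_getElem (by omega)] at this
      simpa using this
    have h4 : (U :: (B ++ D :: C)).take (2 * B.count D + 2) = U :: (B ++ [D]) := by
      have : U :: (B ++ D :: C) = (U :: (B ++ [D])) ++ C := by simp
      rw [this]
      exact List.take_left' (by simp; omega)
    have h5 : ((U :: (B ++ D :: C)).take (B.count D + 2)).Sublist (U :: (B ++ [D])) := by
      rw [← h4]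
      exact List.take_sublist_take_left (by omega)
    have h6 := h5.count_le U
    rw [h3, List.count_replicate_self] at h6
    simp at h6
    omega

/-! ### Recursion and bijectivity of `Theta` -/

theorem Theta_ins {n k : ℕ} {w : List ℕ} (hw : w ∈ Av n [3, 2, 1]) (hk1 : 1 ≤ k)
    (hkn : k ≤ n + 1) (hinc : ∀ x y, k ≤ y → y < x → ¬ [x, y].Sublist w) :
    Theta (ins w (n + 1) k) =
      ins (Theta w) (n + 1 - k + (matchedBelow w k + 1)) (matchedBelow w k + 1) ∧
    IsLeast {i | i ∈ nonExcedances (Theta (ins w (n + 1) k))}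
      (n + 1 - k + (matchedBelow w k + 1)) ∧
    matchedBelow w k + 1 ≤ k := by
  obtain ⟨hD, hn⟩ := Psi_isDyck hw
  obtain ⟨hD', hn'⟩ := Psi_isDyck (ins_mem_Av hw hk1 hkn hinc)
  have hl := length_of_mem_S hw.1
  have hPl := length_Psi w
  have hd := count_D_take_Psi hw hkn
  have hXl := count_add_count ((Psi w).take (k - 1))
  unfold Theta
  rw [Psi_ins hw hk1 hkn hinc] at hD' hn' ⊢
  have hXY := List.take_append_drop (k - 1) (Psi w)
  set X := (Psi w).take (k - 1) with hX
  set Y := (Psi w).drop (k - 1) with hY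
  have hXlen : X.length = k - 1 := by
    rw [hX, List.length_take]
    omega
  have hc : X.count U + Y.count U = n := by rw [← List.count_append, hXY, hn]
  -- Of the `k - 1` steps of `X`, `matchedBelow w k` are down-steps; the remaining up-steps are
  -- missing from `Y`.
  have hYc : Y.count U + 1 = n + 1 - k + (matchedBelow w k + 1) := by omega
  rw [← hYc]
  refine ⟨?_, isLeast_nonExcedances hD' hn' (by omega) ?_, by omega⟩
  · rw [← hXY] at hD
    rw [PhiInv_peak hD, hXY, hd]
  · intro p hp hpn
    -- Counted from 0, position `k` is the down-step of the inserted peak.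
    rcases (show k ≤ p by omega).eq_or_lt with rfl | hkp
    · rw [List.getElem?_append_right (by omega), show k - X.length = 1 by omega]
      simp
    · obtain ⟨q, rfl⟩ := Nat.exists_eq_add_of_le' (show 2 ≤ p by omega)
      rw [getElem?_peak (by omega), show q + 2 + 1 = (q + 1) + 2 by omega,
        getElem?_peak (by omega), hXY, getElem?_Psi_eq_U hl (by omega),
        getElem?_Psi_eq_U hl (by omega)]
      exact (increasing_from_iff hw hk1).1 hinc (q + 1) (by omega) (by omega)

theorem Theta_mapsTo (n : ℕ) : Set.MapsTo Theta (Av n [3, 2, 1]) (Av n [1, 3, 2]) := by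
  intro σ hσ
  obtain ⟨h1, h2⟩ := Psi_isDyck hσ
  exact PhiInv_mem_Av h1 h2

theorem Theta_surjOn (n : ℕ) : Set.SurjOn Theta (Av n [3, 2, 1]) (Av n [1, 3, 2]) := by
  intro α hα
  obtain ⟨w, h1, h2, rfl⟩ := exists_PhiInv_eq hα
  obtain ⟨σ, hσ, rfl⟩ := exists_Psi_eq h1 h2
  exact ⟨σ, hσ, rfl⟩

theorem letter_ins {w : List ℕ} {a b : ℕ} (h1 : 1 ≤ a) (h2 : a ≤ w.length + 1) :
    letter (ins w a b) a = b := by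
  obtain ⟨a, rfl⟩ := Nat.exists_eq_add_of_le' h1
  refine letter_eq ?_
  rw [getElem?_ins (by omega)]
  simp

/-- The recursion for `Θ`. -/
theorem Theta_rec {n : ℕ} {σ : List ℕ} (hσ : σ ∈ Av (n + 1) [3, 2, 1]) :
    ∃ π k j, π = red (σ.take n) ∧ k = letter σ (n + 1) ∧ j = matchedBelow σ k + 1 ∧
      π ∈ Av n [3, 2, 1] ∧ σ = ins π (n + 1) k ∧ j = matchedBelow π k + 1 ∧
      1 ≤ j ∧ j ≤ k ∧ k ≤ n + 1 ∧
      Theta σ = ins (Theta π) (n + 1 - k + j) j ∧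
      IsLeast {i | i ∈ nonExcedances (Theta σ)} (n + 1 - k + j) ∧
      letter (Theta σ) (n + 1 - k + j) = j := by
  obtain ⟨h1, h2, h3, h4, h5⟩ := exists_eq_ins hσ
  obtain ⟨h6, h7, h8⟩ := Theta_ins h1 h2 h3 h5
  have h9 := matchedBelow_ins h1 (h4 ▸ hσ) h2 h3 h5
  rw [← h4] at h6 h7 h9
  refine ⟨_, _, _, rfl, rfl, rfl, h1, h4, by rw [h9], by omega, by omega, h3,
    by rw [h9]; exact h6, by rw [h9]; exact h7, ?_⟩
  rw [h9, h6]
  have := length_of_mem_S (Theta_mapsTo n h1).1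
  exact letter_ins (by omega) (by omega)

/-- The smallest non-excedance `n + 1 - k + j` and its letter `j` can be read off from `Theta σ`;
they give `k`, then `Theta π`, then `π` by induction. -/
theorem Theta_injOn (n : ℕ) : Set.InjOn Theta (Av n [3, 2, 1]) := by
  induction n with
  | zero =>
    intro σ hσ σ' hσ' _
    rw [List.length_eq_zero_iff.1 (length_of_mem_S hσ.1),
      List.length_eq_zero_iff.1 (length_of_mem_S hσ'.1)]
  | succ n ih =>
    intro σ hσ σ' hσ' h
    obtain ⟨π, k, j, -, -, -, hπ, h1, -, hj1, hjk, hk, h2, h3, h4⟩ := Theta_rec hσ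
    obtain ⟨π', k', j', -, -, -, hπ', h1', -, hj1', hjk', hk', h2', h3', h4'⟩ := Theta_rec hσ'
    rw [← h] at h2' h3' h4'
    have h5 := h3.unique h3'
    rw [← h5, h4] at h4'
    obtain rfl : j = j' := h4'
    obtain rfl : k = k' := by omega
    have hl := length_of_mem_S (Theta_mapsTo n hπ).1
    have hl' := length_of_mem_S (Theta_mapsTo n hπ').1
    have h6 : Theta π = Theta π' := by
      have h7 := h2.symm.trans h2'
      rw [show n + 1 - k + j = (n + 1 - k + (j - 1)) + 1 by omega] at h7
      exact ins_injective (hl.trans hl'.symm) (by omega) h7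
    rw [h1, h1', ih hπ hπ' h6]

theorem Theta_bijOn (n : ℕ) : Set.BijOn Theta (Av n [3, 2, 1]) (Av n [1, 3, 2]) :=
  ⟨Theta_mapsTo n, Theta_injOn n, Theta_surjOn n⟩

theorem Theta_injOn_iUnion : Set.InjOn Theta (⋃ n, Av n [3, 2, 1]) := by
  intro σ hσ σ' hσ' h
  obtain ⟨n, hn⟩ := Set.mem_iUnion.1 hσ
  obtain ⟨m, hm⟩ := Set.mem_iUnion.1 hσ'
  have h1 := length_of_mem_S (Theta_mapsTo n hn).1
  have h2 := length_of_mem_S (Theta_mapsTo m hm).1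
  obtain rfl : n = m := by rw [← h1, ← h2, h]
  exact Theta_injOn n hn hm h

theorem ThetaInv_Theta {n : ℕ} {σ : List ℕ} (hσ : σ ∈ Av n [3, 2, 1]) :
    ThetaInv (Theta σ) = σ :=
  Theta_injOn_iUnion.leftInvOn_invFunOn (Set.mem_iUnion.2 ⟨n, hσ⟩)

theorem eq_of_mem_S_one {w : List ℕ} (hw : w ∈ S 1) : w = [1] :=
  List.perm_singleton.1 (show w.Perm [1] from hw)

end ElizaldePak

theorem mainTheorem3 (n : ℕ) :
    Set.BijOn ElizaldePak.Theta (ElizaldePak.Av n [3, 2, 1]) (ElizaldePak.Av n [1, 3, 2]) ∧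
    (∀ σ ∈ ElizaldePak.Av n [3, 2, 1],
      (n = 1 → ElizaldePak.Theta σ = σ) ∧
      (1 < n → ∀ (k : ℕ) (π : List ℕ) (j : ℕ),
        k = ElizaldePak.letter σ n →
        π = ElizaldePak.red (σ.take (n - 1)) →
        j = ElizaldePak.matchedBelow σ k + 1 →
          π ∈ ElizaldePak.Av (n - 1) [3, 2, 1] ∧
          σ = ElizaldePak.ins π n k ∧
          j = ElizaldePak.matchedBelow π k + 1 ∧
          ElizaldePak.Theta σ = ElizaldePak.ins (ElizaldePak.Theta π) (n - k + j) j ∧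
          IsLeast {i | i ∈ ElizaldePak.nonExcedances (ElizaldePak.Theta σ)} (n - k + j))) ∧
    (∀ α ∈ ElizaldePak.Av n [1, 3, 2],
      (n = 1 → ElizaldePak.ThetaInv α = α) ∧
      (1 < n → ∃ k, IsLeast {i | i ∈ ElizaldePak.nonExcedances α} k ∧
        ∃ β ∈ ElizaldePak.Av (n - 1) [1, 3, 2],
          ElizaldePak.ins β k (ElizaldePak.letter α k) = α ∧
          (∀ β' ∈ ElizaldePak.S (n - 1),
            ElizaldePak.ins β' k (ElizaldePak.letter α k) = α → β' = β) ∧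
          ElizaldePak.ThetaInv α =
            ElizaldePak.ins (ElizaldePak.ThetaInv β) n (n + ElizaldePak.letter α k - k))) := by
  open ElizaldePak in
  refine ⟨Theta_bijOn n, fun σ hσ => ⟨?_, ?_⟩, fun α hα => ⟨?_, ?_⟩⟩
  · rintro rfl
    rw [eq_of_mem_S_one (Theta_mapsTo 1 hσ).1, eq_of_mem_S_one hσ.1]
  · intro hn k π j hk hπ hj
    obtain ⟨n, rfl⟩ := Nat.exists_eq_add_of_le' hn.le
    obtain ⟨_, _, _, rfl, rfl, rfl, h1, h2, h3, -, -, -, h4, h5, -⟩ := Theta_rec hσ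
    subst hk hπ hj
    exact ⟨h1, h2, h3, h4, h5⟩
  · rintro rfl
    obtain ⟨σ, hσ, rfl⟩ := Theta_surjOn 1 hα
    rw [ThetaInv_Theta hσ, eq_of_mem_S_one hα.1, eq_of_mem_S_one hσ.1]
  · intro hn
    obtain ⟨n, rfl⟩ := Nat.exists_eq_add_of_le' hn.le
    obtain ⟨σ, hσ, rfl⟩ := Theta_surjOn _ hα
    obtain ⟨π, k, j, -, -, -, hπ, h1, -, hj1, hjk, hk, h2, h3, h4⟩ := Theta_rec hσ
    have hl := length_of_mem_S (Theta_mapsTo n hπ).1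
    refine ⟨_, h3, Theta π, Theta_mapsTo n hπ, by rw [h4, ← h2], ?_, ?_⟩
    · intro β' hβ' h
      rw [h4, h2, show n + 1 - k + j = (n + 1 - k + (j - 1)) + 1 by omega] at h
      have hl' := length_of_mem_S hβ'
      exact ins_injective (by simpa [hl] using hl') (by simp at hl'; omega) h
    -- The truncated subtractions are exact because `j ≤ k ≤ n + 1`.
    · rw [ThetaInv_Theta hσ, ThetaInv_Theta hπ, h4,
        show n + 1 + j - (n + 1 - k + j) = k by omega]
      exact h1
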